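/- Let $\{x(n)\}_{n\in\mathbb Z}$ be a complex second-order random process with autocorrelation $r_x(n,m)=\mathbb E[x(n+m)x^*(n)]$, cyclostationary with period $P\ge 1$: $r_x(n+lP,m)=r_x(n,m)$ for all $n,m,l\in\mathbb Z$. Assume $\sum_{m}|r_x(n,m)|<\infty$ for every $n$, so that the cyclic spectrum $$S_X^{(k/P)}(f)=\frac1P\sum_{n=0}^{P-1}\sum_{m\in\mathbb Z}r_x(n,m)\,e^{-j2\pi(kn/P+fm)}\qquad(k\in\mathbb Z)$$ is well defined. For $\sigma\in[0,1/P)$ let $\mathbf S_X(\sigma)\in\mathbb C^{P\times P}$ be the cyclic PSD matrix with entries $[\mathbf S_X(\sigma)]_{r,c}=S_X^{((r-c)/P)}(\sigma+r/P)$, $0\le r,c\le P-1$. A family $\{\phi(n,\lambda)\}_{n\in\mathbb Z,\lambda\in[0,1)}$ is called a Karhunen–Loève (KL) eigenbasis of $x$ with KL spectrum $\mathcal S:[0,1)\to\mathbb R$ if $\phi(n,\cdot)\in L^2[0,1)$ for every $n$ and: $\int_0^1\phi(n,\lambda)\phi^*(n',\lambda)\,d\lambda=\delta_{n-n'}$;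 $\sum_n\phi(n,\lambda)\phi^*(n,\lambda')=\delta(\lambda-\lambda')$ as operators on $L^2[0,1)$; for almost every $\lambda$, $\sum_{l}r_x(l,k-l)\phi(l,\lambda)=\mathcal S(\lambda)\phi(k,\lambda)$ for all $k\in\mathbb Z$; and $\mathcal S$ is integrable and a.e. non-negative, with $x(n)=\int_0^1\phi(n,\lambda)\,d\xi(\lambda)$ for all $n$, a Doob integral against some random measure $\xi$ with $\mathbb E[\xi(A)\xi^*(B)]=\int_{A\cap B}\mathcal S(\lambda)\,d\lambda$. Write $\phi^{(p)}(n,\sigma)=\phi(n,\sigma+p/P)$ and $\mathcal S^{(p)}(\sigma)=\mathcal S(\sigma+p/P)$ for $p\in\{0,\dots,P-1\}$, $\sigma\in[0,1/P)$. Then: 1. For every $\sigma\in[0,1/P)$, $\mathbf S_X(\sigma)$ is Hermitian and non-negative definite. 2. For every $\sigma\in[0,1/P)$, $\mathbf b=(b(0),\dots,b(P-1))\in\mathbb C^P$ and $\mu\in\mathbb C$, the function $\varphi(n)=\sum_{q=0}^{P-1}b(q)e^{j2\pi(\sigma+q/P)n}$ is not identically zero and satisfies $\sum_l r_x(l,k-l)\varphi(l)=\mu\,\varphi(k)$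 for all $k\in\mathbb Z$ if and only if $\mathbf b\ne 0$ and $\mathbf S_X(\sigma)\mathbf b=\mu\mathbf b$. 3. Let $\phi^{(p)}(n,\sigma)=\sum_{q=0}^{P-1}b^{(p)}(q,\sigma)e^{j2\pi(\sigma+q/P)n}$ with coefficient vectors $\mathbf b^{(p)}(\sigma)=(b^{(p)}(0,\sigma),\dots,b^{(p)}(P-1,\sigma))$ measurable in $\sigma$, and let $\mathcal S:[0,1)\to\mathbb R$. Then $\phi$ is a KL eigenbasis of $x$ with KL spectrum $\mathcal S$ if and only if, for almost every $\sigma\in[0,1/P)$, the vectors $\mathbf b^{(0)}(\sigma),\dots,\mathbf b^{(P-1)}(\sigma)$ are orthonormal and $\mathbf S_X(\sigma)\mathbf b^{(p)}(\sigma)=\mathcal S^{(p)}(\sigma)\mathbf b^{(p)}(\sigma)$ for all $p$. 4. A KL eigenbasis of $x$ of the form in 3 exists, with measurable $\mathbf b^{(p)}$ for which the vectors $\mathbf b^{(p)}(\sigma)$ are orthonormal eigenvectors of $\mathbf S_X(\sigma)$ with eigenvalues $\mathcal S^{(p)}(\sigma)$ for every $\sigma\in[0,1/P)$. -/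

import Mathlib

open MeasureTheory Filter Set
open scoped Topology ComplexConjugate Matrix ComplexOrder

noncomputable section

namespace CycloKL

variable {Ω : Type*} [MeasurableSpace Ω]

/-- The autocorrelation `r_x(n, m) = E[x(n+m) x*(n)]` of a discrete-time complex process. -/
def autocorr (ℙ : Measure Ω) (x : ℤ → Ω → ℂ) (n m : ℤ) : ℂ :=
  ∫ ω, x (n + m) ω * conj (x n ω) ∂ℙ

/-- A second-order process is cyclostationary with period `P` if its autocorrelation is
`P`-periodic in the time index. -/
structure IsCyclostationary (ℙ : Measure Ω) (x : ℤ → Ω → ℂ) (P : ℕ) : Prop where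
  period_pos : 0 < P
  second_order : ∀ n, MemLp (x n) 2 ℙ
  periodic : ∀ n m l : ℤ, autocorr ℙ x (n + l * P) m = autocorr ℙ x n m

/-- The complex exponential `e^{j 2π f n}`. -/
def expo (f : ℝ) (n : ℤ) : ℂ := Complex.exp (2 * Real.pi * Complex.I * f * n)

/-- The cyclic spectrum `S_X^{(k/P)}(f)`, the Fourier transform of the autocorrelation in time
(over one period) and in lag. The formula makes sense for every integer `k`
(and is `P`-periodic in `k`). -/
def cyclicSpectrum (ℙ : Measure Ω) (x : ℤ → Ω → ℂ) (P : ℕ) (k : ℤ) (f : ℝ) : ℂ :=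
  (1 / (P : ℂ)) * ∑ n ∈ Finset.range P, ∑' m : ℤ, autocorr ℙ x n m *
    Complex.exp (-(2 * Real.pi * Complex.I * ((k : ℂ) * n / P + f * m)))

/-- The `P × P` cyclic PSD matrix, with `(r, c)` entry `S_X^{((r-c)/P)}(σ + r/P)`. -/
def cyclicPSD (ℙ : Measure Ω) (x : ℤ → Ω → ℂ) (P : ℕ) (σ : ℝ) : Matrix (Fin P) (Fin P) ℂ :=
  Matrix.of fun r c =>
    cyclicSpectrum ℙ x P (((r : ℕ) : ℤ) - ((c : ℕ) : ℤ)) (σ + ((r : ℕ) : ℝ) / (P : ℝ))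

/-- The function `n ↦ ∑_q b(q) e^{j 2π (σ + q/P) n}`. -/
def csFun {P : ℕ} (b : Fin P → ℂ) (σ : ℝ) (n : ℤ) : ℂ :=
  ∑ q : Fin P, b q * expo (σ + ((q : ℕ) : ℝ) / (P : ℝ)) n

/-- The eigenequation `∑_l r_x(l, k-l) φ(l) = μ φ(k)` for all `k`
(convergence of the series is part of the claim). -/
def Eigenequation (ℙ : Measure Ω) (x : ℤ → Ω → ℂ) (φ : ℤ → ℂ) (μ : ℂ) : Prop :=
  ∀ k : ℤ, HasSum (fun l : ℤ => autocorr ℙ x l (k - l) * φ l) (μ * φ k)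

/-- Lebesgue measure on the KL domain `[0, 1)`. -/
def unitBand : Measure ℝ := volume.restrict (Ico 0 1)

/-- The measure `S(lam) d lam` on `[0, 1)`. -/
def spectralMeasure (S : ℝ → ℝ) : Measure ℝ :=
  unitBand.withDensity fun lam => ENNReal.ofReal (S lam)

/-- `ξ` is a random measure on `[0, 1)` with orthogonal increments and power density `S`, that is
`E[dξ(lam) dξ*(lam - β)] = S(lam) δ(β) dβ d lam`. -/
structure IsOrthogonalMeasure (ℙ : Measure Ω) (S : ℝ → ℝ) (ξ : Set ℝ → Ω → ℂ) : Prop where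
  memLp : ∀ A, MeasurableSet A → A ⊆ Ico 0 1 → MemLp (ξ A) 2 ℙ
  orthogonal : ∀ A B, MeasurableSet A → MeasurableSet B → A ⊆ Ico 0 1 → B ⊆ Ico 0 1 →
    ∫ ω, ξ A ω * conj (ξ B ω) ∂ℙ = ((∫ lam in A ∩ B, S lam : ℝ) : ℂ)

/-- The integral `∫_0^1 g dξ` of a simple function against a random measure. -/
def simpleIntegral (ξ : Set ℝ → Ω → ℂ) (g : SimpleFunc ℝ ℂ) (ω : Ω) : ℂ :=
  ∑ c ∈ g.range, c * ξ (g ⁻¹' {c} ∩ Ico 0 1) ω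

/-- `Y = ∫_0^1 f dξ` as a Doob integral: `Y` is the mean-square limit of the integrals of simple
functions that converge to `f` in `L²(S d lam)`. -/
def IsDoobIntegral (ℙ : Measure Ω) (S : ℝ → ℝ) (ξ : Set ℝ → Ω → ℂ) (f : ℝ → ℂ) (Y : Ω → ℂ) :
    Prop :=
  ∃ g : ℕ → SimpleFunc ℝ ℂ,
    Tendsto (fun j => eLpNorm (fun lam => f lam - g j lam) 2 (spectralMeasure S)) atTop (𝓝 0) ∧
    Tendsto (fun j => eLpNorm (fun ω => Y ω - simpleIntegral ξ (g j) ω) 2 ℙ) atTop (𝓝 0)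

/-- The functions `φ(n, lam)`, `lam ∈ [0, 1)`, form a Karhunen–Loève eigenbasis of the process `x`
and `S` is the associated KL spectrum. -/
structure IsKLEigenbasis (ℙ : Measure Ω) (x : ℤ → Ω → ℂ) (φ : ℤ → ℝ → ℂ) (S : ℝ → ℝ) :
    Prop where
  memLp : ∀ n, MemLp (φ n) 2 unitBand
  /-- `∫_0^1 φ(n, lam) φ*(n', lam) d lam = δ_{n - n'}` -/
  orthonormal : ∀ n n' : ℤ,
    ∫ lam, φ n lam * conj (φ n' lam) ∂unitBand = if n = n' then 1 else 0
  /-- `∑_n φ(n, lam) φ*(n, lam') = δ(lam - lam')`, as an identity of operators on `L²[0, 1)` -/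
  complete : ∀ f : ℝ → ℂ, MemLp f 2 unitBand →
    Tendsto (fun s : Finset ℤ => eLpNorm (fun lam =>
      ∑ n ∈ s, φ n lam * (∫ lam', conj (φ n lam') * f lam' ∂unitBand) - f lam) 2 unitBand)
      atTop (𝓝 0)
  eigen : ∀ᵐ lam ∂unitBand, Eigenequation ℙ x (fun n => φ n lam) (S lam)
  spectrum_nonneg : ∀ᵐ lam ∂unitBand, 0 ≤ S lam
  spectrum_integrable : Integrable S unitBand
  /-- `x(n) = ∫_0^1 φ(n, lam) dξ(lam)` with orthogonal increments of density `S` -/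
  expansion : ∃ ξ : Set ℝ → Ω → ℂ, IsOrthogonalMeasure ℙ S ξ ∧
    ∀ n, IsDoobIntegral ℙ S ξ (φ n) (x n)

/-- `φ^{(p)}(n, σ) = φ(n, σ + p/P)` equals `∑_q b^{(p)}(q, σ) e^{j 2π (σ + q/P) n}` for all
`p ∈ {0, …, P-1}` and `σ ∈ [0, 1/P)`; here `b p σ` is the coefficient vector `b^{(p)}(σ)`. -/
def HasCSForm (P : ℕ) (φ : ℤ → ℝ → ℂ) (b : Fin P → ℝ → Fin P → ℂ) : Prop :=
  ∀ (p : Fin P), ∀ σ ∈ Ico (0 : ℝ) (1 / (P : ℝ)), ∀ n : ℤ,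
    φ n (σ + ((p : ℕ) : ℝ) / (P : ℝ)) = csFun (b p σ) σ n

/-- The vectors `v p` are an orthonormal basis of `ℂ^P` of eigenvectors of `A`, with
eigenvalues `μ p`. -/
def IsOrthonormalEigenbasis {P : ℕ} (A : Matrix (Fin P) (Fin P) ℂ) (v : Fin P → Fin P → ℂ)
    (μ : Fin P → ℝ) : Prop :=
  Orthonormal ℂ (fun p => (WithLp.toLp 2 (v p) : EuclideanSpace ℂ (Fin P))) ∧
    ∀ p, A *ᵥ v p = (μ p : ℂ) • v p

end CycloKL

end

noncomputable section

namespace CycloKL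

variable {Ω : Type*} [MeasurableSpace Ω]

/-! The correlation operator commutes with shifts by `P`, so it preserves the sequences that a shift
by `P` multiplies by `expo σ P`. These form a `P`-dimensional space spanned by the exponentials of
frequency `σ + q/P`, and in that basis the operator is the cyclic PSD matrix
(`hasSum_autocorr_mul_csFun`). Injectivity of `csFun` turns the eigenequation into the matrix one
(`eigenequation_csFun_iff`). The matrix is a limit of normalised Gram matrices of finite Fourier
sums of the process, hence positive semidefinite (`posSemidef_cyclicPSD`).

For families of the given form, Fourier uniqueness on `[0, 1/P)`
(`ae_eq_zero_of_integral_csFun_eq_zero`) converts integral identities valid for all `n` into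
pointwise identities for the coefficients. It shows that orthonormality in `L²[0, 1)` forces
orthonormal coefficient vectors, and that orthonormal coefficient vectors give a total family.
Orthonormality of the family follows from that of the vectors because a unitary change of basis does
not alter the kernel of the `P` exponentials (`sum_csFun_mul_conj`).

For the expansion, integrating the eigenequation against `conj (φ m)` shows that `φ n` in `L²(S)`
and `x n` in `L²(Ω)` have the same Gram matrix (`integral_spectrum_mul_eq_autocorr`). An isometry
therefore sends `φ n` to `x n`, and its values on indicators form the random measure
(`exists_orthogonalMeasure`). Existence reduces to a measurable choice of orthonormal eigenvectors
(`exists_measurable_eigenbasis`). -/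

/-! ### Exponentials and Fourier analysis on `ℤ / P`. -/

lemma expo_add (f g : ℝ) (n : ℤ) : expo (f + g) n = expo f n * expo g n := by
  simp only [expo, ← Complex.exp_add]; congr 1; push_cast; ring

lemma expo_add_int (f : ℝ) (m n : ℤ) : expo f (m + n) = expo f m * expo f n := by
  simp only [expo, ← Complex.exp_add]; congr 1; push_cast; ring

@[simp] lemma expo_zero_right (f : ℝ) : expo f 0 = 1 := by simp [expo]

lemma norm_expo (f : ℝ) (n : ℤ) : ‖expo f n‖ = 1 := by
  have : expo f n = Complex.exp (((2 * Real.pi * f * n : ℝ) : ℂ) * Complex.I) := by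
    simp only [expo]; congr 1; push_cast; ring
  rw [this, Complex.norm_exp_ofReal_mul_I]

lemma conj_expo (f : ℝ) (n : ℤ) : conj (expo f n) = expo f (-n) := by
  simp only [expo, ← Complex.exp_conj]; congr 1; simp [Complex.conj_ofNat]

lemma expo_div_swap (P : ℕ) (q n : ℤ) : expo (q / P) n = expo (n / P) q := by
  simp only [expo]; congr 1; push_cast; ring

lemma expo_div_mul {P : ℕ} (hP : 0 < P) (q l : ℤ) : expo (q / P) (l * P) = 1 := by
  have hP' : (P : ℂ) ≠ 0 := by exact_mod_cast hP.ne'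
  have : expo (q / P) (l * P) = Complex.exp ((q * l : ℤ) * (2 * Real.pi * Complex.I)) := by
    simp only [expo]; congr 1; push_cast; field_simp
  rw [this, Complex.exp_int_mul_two_pi_mul_I]

lemma expo_one_div_eq_one_iff {P : ℕ} (hP : 0 < P) (n : ℤ) :
    expo (n / P) 1 = 1 ↔ (P : ℤ) ∣ n := by
  have hP' : (P : ℂ) ≠ 0 := by exact_mod_cast hP.ne'
  constructor
  · intro h
    rw [expo, Complex.exp_eq_one_iff] at h
    obtain ⟨k, hk⟩ := h
    have hpi : (2 * Real.pi * Complex.I : ℂ) ≠ 0 := Complex.two_pi_I_ne_zero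
    refine ⟨k, ?_⟩
    push_cast at hk
    have h2 : (n : ℂ) / P = k := by
      apply mul_left_cancel₀ hpi
      linear_combination hk
    rw [div_eq_iff hP'] at h2
    have : (n : ℂ) = ((P * k : ℤ) : ℂ) := by rw [h2]; push_cast; ring
    exact_mod_cast this
  · rintro ⟨k, rfl⟩
    have := expo_div_mul hP 1 k
    rw [← this, mul_comm (P : ℤ) k, ← expo_div_swap]

lemma sum_expo_div {P : ℕ} (hP : 0 < P) (n : ℤ) :
    ∑ r : Fin P, expo (((r : ℕ) : ℝ) / P) n = if (P : ℤ) ∣ n then (P : ℂ) else 0 := by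
  have h1 : ∀ r : Fin P, expo (((r : ℕ) : ℝ) / P) n = expo (n / P) 1 ^ (r : ℕ) := by
    intro r
    rw [expo, expo, ← Complex.exp_nat_mul]
    congr 1; push_cast; ring
  simp_rw [h1]
  rw [Fin.sum_univ_eq_sum_range (fun r => expo (n / P) 1 ^ r)]
  split_ifs with h
  · simp [(expo_one_div_eq_one_iff hP n).2 h]
  · have h2 : expo (n / P) 1 ≠ 1 := fun h' => h ((expo_one_div_eq_one_iff hP n).1 h')
    rw [geom_sum_eq h2]
    have : expo (n / P) 1 ^ P = 1 := by
      rw [← expo_div_mul hP 1 n, expo_div_swap, expo, expo, ← Complex.exp_nat_mul]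
      congr 1; push_cast; ring
    simp [this]

/-- Fourier inversion on `ℤ / P`. -/
lemma sum_periodic_mul_expo {P : ℕ} (hP : 0 < P) (g : ℤ → ℂ) (hg : ∀ n l : ℤ, g (n + l * P) = g n)
    (t : ℤ) :
    ∑ n ∈ Finset.range P, ∑ r : Fin P, g n * expo (((r : ℕ) : ℝ) / P) (t - n) = P * g t := by
  have hPz : (0 : ℤ) < P := by exact_mod_cast hP
  simp_rw [← Finset.mul_sum, sum_expo_div hP]
  have hn := Int.emod_nonneg t hPz.ne'
  rw [Finset.sum_eq_single (t % P).toNat]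
  · have h1 : ((t % P).toNat : ℤ) = t % P := Int.toNat_of_nonneg hn
    have h2 : g (t % P) = g t := by
      conv_rhs => rw [← Int.emod_add_mul_ediv t P, mul_comm (P : ℤ) _, hg]
    rw [h1, if_pos (Int.dvd_self_sub_emod), h2, mul_comm]
  · intro n hn' hne
    rw [if_neg, mul_zero]
    intro hd
    apply hne
    have hlt := Finset.mem_range.1 hn'
    have : t % P = (n : ℤ) % P := ((Int.modEq_iff_dvd (n := P)).2 hd).symm
    rw [this, Int.emod_eq_of_lt (by positivity) (by exact_mod_cast hlt)]
    simp
  · intro h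
    exfalso; apply h
    rw [Finset.mem_range]
    have := Int.emod_lt_of_pos t hPz
    omega

/-- On one period the `P` exponentials are orthogonal with squared norm `P`. This recovers the
coefficients linearly from `P` samples, which gives injectivity and later their square
integrability. -/
lemma csFun_inversion {P : ℕ} (b : Fin P → ℂ) (σ : ℝ) (q : Fin P) :
    b q = (1 / (P : ℂ)) * ∑ n ∈ Finset.range P,
      csFun b σ n * conj (expo (σ + ((q : ℕ) : ℝ) / P) n) := by
  have hP : 0 < P := q.pos
  have hP' : (P : ℂ) ≠ 0 := by exact_mod_cast hP.ne'
  have h1 : ∀ n : ℕ, csFun b σ n * conj (expo (σ + ((q : ℕ) : ℝ) / P) n) =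
      ∑ q' : Fin P, b q' * expo (((n : ℕ) : ℝ) / P) ((q' : ℤ) - (q : ℤ)) := by
    intro n
    rw [csFun, Finset.sum_mul]
    refine Finset.sum_congr rfl fun q' _ => ?_
    rw [mul_assoc]; congr 1
    rw [conj_expo]
    simp only [expo, ← Complex.exp_add]; congr 1; push_cast; ring
  simp_rw [h1]
  rw [Finset.sum_comm, ]
  have h2 : ∀ q' : Fin P, ∑ n ∈ Finset.range P, b q' * expo (((n : ℕ) : ℝ) / P) ((q' : ℤ) - (q : ℤ))
      = if q' = q then P * b q else 0 := by
    intro q'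
    rw [← Finset.mul_sum, ← Fin.sum_univ_eq_sum_range
      (fun n => expo (((n : ℕ) : ℝ) / P) ((q' : ℤ) - (q : ℤ))), sum_expo_div hP]
    by_cases h : q' = q
    · subst h; simp [mul_comm]
    · rw [if_neg, if_neg h, mul_zero]
      intro hd
      apply h
      have h3 := Int.eq_zero_of_abs_lt_dvd hd (by
        have := q'.2; have := q.2
        rw [abs_lt]; constructor <;> omega)
      ext; omega
  simp_rw [h2]
  simp [hP']

lemma csFun_injective {P : ℕ} (σ : ℝ) {b c : Fin P → ℂ} (h : ∀ n, csFun b σ n = csFun c σ n) :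
    b = c := by
  ext q
  rw [csFun_inversion b σ q, csFun_inversion c σ q]
  simp_rw [h]

lemma csFun_zero {P : ℕ} (σ : ℝ) : csFun (0 : Fin P → ℂ) σ = 0 := by
  ext n; simp [csFun]

lemma csFun_smul {P : ℕ} (μ : ℂ) (b : Fin P → ℂ) (σ : ℝ) (n : ℤ) :
    csFun (μ • b) σ n = μ * csFun b σ n := by
  simp [csFun, Finset.mul_sum, mul_assoc]

/-- On multiples of `P` the frequencies `q/P` make whole turns, so the multiplier does not depend on
`q`. -/
lemma csFun_add_mul {P : ℕ} (b : Fin P → ℂ) (σ : ℝ) (n l : ℤ) :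
    csFun b σ (n + l * P) = expo σ (l * P) * csFun b σ n := by
  simp only [csFun, Finset.mul_sum]
  refine Finset.sum_congr rfl fun q _ => ?_
  have := expo_div_mul q.pos (q : ℕ) l
  rw [expo_add_int, expo_add _ _ (l * P)]
  push_cast at this
  rw [this]; ring

lemma norm_csFun_le {P : ℕ} (b : Fin P → ℂ) (σ : ℝ) (n : ℤ) : ‖csFun b σ n‖ ≤ ∑ q, ‖b q‖ := by
  refine (norm_sum_le _ _).trans (Finset.sum_le_sum fun q _ => ?_)
  rw [norm_mul, norm_expo, mul_one]

/-! ### The correlation operator on the span of the `P` exponentials. -/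

section Spectrum

variable {ℙ : Measure Ω} {x : ℤ → Ω → ℂ} {P : ℕ}

/-- Regrouping the phase as `(σ + r/P)(n + m) - (σ + c/P) n` exhibits the entry as a correlation of
two Fourier components. -/
lemma cyclicPSD_apply (σ : ℝ) (r c : Fin P) :
    cyclicPSD ℙ x P σ r c = (1 / (P : ℂ)) * ∑ n ∈ Finset.range P, ∑' m : ℤ, autocorr ℙ x n m *
      (conj (expo (σ + ((r : ℕ) : ℝ) / P) (n + m)) * expo (σ + ((c : ℕ) : ℝ) / P) n) := by
  simp only [cyclicPSD, Matrix.of_apply, cyclicSpectrum]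
  congr 1
  refine Finset.sum_congr rfl fun n _ => tsum_congr fun m => ?_
  congr 1
  rw [conj_expo]
  simp only [expo, ← Complex.exp_add]
  congr 1; push_cast; ring

lemma autocorr_mul_csFun_eq (hx : IsCyclostationary ℙ x P) (b : Fin P → ℂ) (σ : ℝ) (k m : ℤ) :
    autocorr ℙ x (k - m) m * csFun b σ (k - m) = (1 / (P : ℂ)) *
      ∑ r : Fin P, ∑ n ∈ Finset.range P,
      (autocorr ℙ x n m * conj (expo (σ + ((r : ℕ) : ℝ) / P) (n + m))) *
        (expo (σ + ((r : ℕ) : ℝ) / P) k * csFun b σ n) := by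
  have hP := hx.period_pos
  have hP' : (P : ℂ) ≠ 0 := by exact_mod_cast hP.ne'
  have h4 : ∀ t : ℤ, 1 = expo σ t * expo σ (-t) := fun t => by
    rw [← expo_add_int, add_neg_cancel, expo_zero_right]
  -- Demodulating by `expo σ (-n)` makes the product periodic, so Fourier inversion on `ℤ / P`
  -- applies at `k - m`.
  have h2 := sum_periodic_mul_expo hP
    (fun n => autocorr ℙ x n m * (csFun b σ n * expo σ (-n))) (by
      intro n l
      rw [hx.periodic, csFun_add_mul, neg_add, expo_add_int]
      linear_combination (-autocorr ℙ x n m * csFun b σ n * expo σ (-n)) * h4 (l * P)) (k - m)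
  rw [Finset.sum_comm] at h2
  have h3 : autocorr ℙ x (k - m) m * csFun b σ (k - m) = (1 / (P : ℂ)) * expo σ (k - m) *
      (P * (autocorr ℙ x (k - m) m * (csFun b σ (k - m) * expo σ (-(k - m))))) := by
    field_simp
    linear_combination (autocorr ℙ x (k - m) m * csFun b σ (k - m)) * h4 (k - m)
  rw [h3, ← h2, mul_assoc, Finset.mul_sum]
  congr 1
  refine Finset.sum_congr rfl fun r _ => ?_
  rw [Finset.mul_sum]
  refine Finset.sum_congr rfl fun n _ => ?_
  have h5 : expo σ (k - m) * (expo σ (-n) * expo (((r : ℕ) : ℝ) / P) (k - m - n)) =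
      conj (expo (σ + ((r : ℕ) : ℝ) / P) (n + m)) * expo (σ + ((r : ℕ) : ℝ) / P) k := by
    rw [conj_expo]
    simp only [expo, ← Complex.exp_add]
    congr 1; push_cast; ring
  linear_combination (autocorr ℙ x n m * csFun b σ n) * h5

/-- Summing over the columns reassembles `csFun b σ n`, which matches the period-wise form in
`autocorr_mul_csFun_eq`. -/
lemma csFun_cyclicPSD_mulVec (b : Fin P → ℂ) (σ : ℝ) (k : ℤ) :
    csFun (cyclicPSD ℙ x P σ *ᵥ b) σ k = (1 / (P : ℂ)) * ∑ r : Fin P, ∑ n ∈ Finset.range P,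
      (∑' m, autocorr ℙ x n m * conj (expo (σ + ((r : ℕ) : ℝ) / P) (n + m))) *
        (expo (σ + ((r : ℕ) : ℝ) / P) k * csFun b σ n) := by
  rw [csFun, Finset.mul_sum]
  refine Finset.sum_congr rfl fun r _ => ?_
  simp only [Matrix.mulVec, dotProduct, cyclicPSD_apply, csFun, Finset.mul_sum, Finset.sum_mul]
  rw [Finset.sum_comm]
  refine Finset.sum_congr rfl fun n _ => Finset.sum_congr rfl fun c _ => ?_
  simp_rw [← mul_assoc]
  rw [tsum_mul_right]
  ring

/-- With the lag `m = k - l` as variable, `autocorr_mul_csFun_eq` splits the series into finitely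
many absolutely convergent ones. -/
lemma hasSum_autocorr_mul_csFun (hx : IsCyclostationary ℙ x P)
    (hsum : ∀ n : ℤ, Summable fun m : ℤ => ‖autocorr ℙ x n m‖) (b : Fin P → ℂ) (σ : ℝ) (k : ℤ) :
    HasSum (fun l : ℤ => autocorr ℙ x l (k - l) * csFun b σ l)
      (csFun (cyclicPSD ℙ x P σ *ᵥ b) σ k) := by
  have hterm : ∀ (n : ℤ) (r : Fin P), Summable fun m : ℤ => autocorr ℙ x n m *
      conj (expo (σ + ((r : ℕ) : ℝ) / P) (n + m)) := by
    intro n r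
    refine Summable.of_norm ?_
    simpa [norm_expo] using hsum n
  rw [← (Equiv.subLeft k).hasSum_iff, csFun_cyclicPSD_mulVec]
  simp only [Function.comp_def, Equiv.subLeft_apply, sub_sub_cancel, autocorr_mul_csFun_eq hx b σ k]
  refine HasSum.mul_left _ (hasSum_sum fun r _ => hasSum_sum fun n _ => ?_)
  exact (hterm n r).hasSum.mul_right _

theorem eigenequation_csFun_iff (hx : IsCyclostationary ℙ x P)
    (hsum : ∀ n : ℤ, Summable fun m : ℤ => ‖autocorr ℙ x n m‖) (b : Fin P → ℂ) (σ : ℝ) (μ : ℂ) :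
    Eigenequation ℙ x (csFun b σ) μ ↔ cyclicPSD ℙ x P σ *ᵥ b = μ • b := by
  constructor
  · intro h
    refine csFun_injective σ fun n => ?_
    rw [csFun_smul]
    exact (hasSum_autocorr_mul_csFun hx hsum b σ n).unique (h n)
  · intro h k
    rw [← csFun_smul, ← h]
    exact hasSum_autocorr_mul_csFun hx hsum b σ k

lemma csFun_ne_zero_iff (b : Fin P → ℂ) (σ : ℝ) : csFun b σ ≠ 0 ↔ b ≠ 0 := by
  refine not_congr ⟨fun h => csFun_injective σ fun n => ?_, fun h => h ▸ csFun_zero σ⟩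
  rw [h, csFun_zero]

end Spectrum

/-! ### Positivity of the cyclic PSD matrix. -/

lemma sum_range_mul_of_periodic {P : ℕ} (g : ℤ → ℂ) (hg : ∀ n l : ℤ, g (n + l * P) = g n)
    (N : ℕ) : ∑ n ∈ Finset.range (N * P), g n = N * ∑ n ∈ Finset.range P, g n := by
  induction N with
  | zero => simp
  | succ N ih =>
    rw [add_mul, one_mul, Finset.sum_range_add, ih]
    have : ∀ n : ℕ, g ((N * P + n : ℕ) : ℤ) = g n := fun n => by
      rw [← hg n N]; congr 1; push_cast; ring
    simp_rw [this]
    push_cast; ring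

/-- Controls the edge effect: few indices leave the window, whatever its length. -/
lemma card_filter_shift_le (T : ℕ) (m : ℤ) :
    ((Finset.range T).filter fun n : ℕ => ¬ (0 ≤ (n : ℤ) + m ∧ (n : ℤ) + m < T)).card ≤
      m.natAbs := by
  rcases le_or_gt 0 m with h | h
  · have : ((Finset.range T).filter fun n : ℕ => ¬ (0 ≤ (n : ℤ) + m ∧ (n : ℤ) + m < T)) ⊆
        Finset.Ico (T - m.natAbs) T := by
      intro n
      simp only [Finset.mem_filter, Finset.mem_range, Finset.mem_Ico]
      omega
    refine (Finset.card_le_card this).trans ?_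
    rw [Nat.card_Ico]; omega
  · have : ((Finset.range T).filter fun n : ℕ => ¬ (0 ≤ (n : ℤ) + m ∧ (n : ℤ) + m < T)) ⊆
        Finset.range m.natAbs := by
      intro n
      simp only [Finset.mem_filter, Finset.mem_range]
      omega
    simpa using Finset.card_le_card this

/-- Truncated averages of a periodic sequence converge to its mean over a period. -/
lemma tendsto_truncated_average {P : ℕ} (hP : 0 < P) (g : ℤ → ℂ)
    (hg : ∀ n l : ℤ, g (n + l * P) = g n) {C : ℝ} (hC : ∀ n, ‖g n‖ ≤ C) (m : ℤ) :
    Tendsto (fun N : ℕ => (1 / (((N + 1) * P : ℕ) : ℂ)) * ∑ n ∈ Finset.range ((N + 1) * P),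
      if 0 ≤ (n : ℤ) + m ∧ (n : ℤ) + m < ((N + 1) * P : ℕ) then g n else 0) atTop
      (𝓝 ((1 / (P : ℂ)) * ∑ n ∈ Finset.range P, g n)) := by
  have hC0 : 0 ≤ C := (norm_nonneg _).trans (hC 0)
  have hPr : (0 : ℝ) < P := by exact_mod_cast hP
  have hP' : (P : ℂ) ≠ 0 := by exact_mod_cast hP.ne'
  rw [tendsto_iff_norm_sub_tendsto_zero]
  -- The window is a whole number of periods, so the only error is the edge effect: at most `|m|`
  -- terms of size `C`, divided by `(N + 1) P`.
  have hlim : Tendsto (fun N : ℕ => (m.natAbs * C / P) * (1 / ((N : ℝ) + 1))) atTop (𝓝 0) := by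
    simpa using tendsto_one_div_add_atTop_nhds_zero_nat.const_mul (m.natAbs * C / P)
  refine squeeze_zero (fun _ => norm_nonneg _) (fun N => ?_) hlim
  have hN : ((N : ℂ) + 1) ≠ 0 := by exact_mod_cast Nat.succ_ne_zero N
  have h1 : (1 / (P : ℂ)) * ∑ n ∈ Finset.range P, g n =
      (1 / (((N + 1) * P : ℕ) : ℂ)) * ∑ n ∈ Finset.range ((N + 1) * P), g n := by
    rw [sum_range_mul_of_periodic g hg]
    push_cast
    field_simp
  rw [h1, ← mul_sub, ← Finset.sum_sub_distrib, norm_mul]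
  have h2 : ‖∑ n ∈ Finset.range ((N + 1) * P),
      ((if 0 ≤ (n : ℤ) + m ∧ (n : ℤ) + m < ((N + 1) * P : ℕ) then g n else 0) - g n)‖ ≤
      m.natAbs * C := by
    have h3 : ∀ n : ℕ, ‖(if 0 ≤ (n : ℤ) + m ∧ (n : ℤ) + m < ((N + 1) * P : ℕ) then g n else 0) - g n‖
        ≤ if ¬ (0 ≤ (n : ℤ) + m ∧ (n : ℤ) + m < ((N + 1) * P : ℕ)) then C else 0 := by
      intro n
      by_cases h : 0 ≤ (n : ℤ) + m ∧ (n : ℤ) + m < ((N + 1) * P : ℕ)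
      · rw [if_pos h, if_neg (not_not.2 h)]; simp
      · rw [if_neg h, if_pos h]; simpa using hC n
    refine (norm_sum_le _ _).trans ((Finset.sum_le_sum fun n _ => h3 n).trans ?_)
    rw [← Finset.sum_filter, Finset.sum_const, nsmul_eq_mul]
    exact mul_le_mul_of_nonneg_right (by exact_mod_cast card_filter_shift_le _ m) hC0
  have h3 : ‖(1 / (((N + 1) * P : ℕ) : ℂ))‖ = 1 / (((N : ℝ) + 1) * P) := by
    rw [norm_div, norm_one, Complex.norm_natCast]; push_cast; rfl
  rw [h3]
  calc _ ≤ 1 / (((N : ℝ) + 1) * P) * (m.natAbs * C) :=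
        mul_le_mul_of_nonneg_left h2 (by positivity)
    _ = _ := by field_simp

lemma posSemidef_of_tendsto {n : Type*} [Fintype n] {A : ℕ → Matrix n n ℂ} {S : Matrix n n ℂ}
    (hA : ∀ N, (A N).PosSemidef) (h : Tendsto A atTop (𝓝 S)) : S.PosSemidef := by
  refine Matrix.PosSemidef.of_dotProduct_mulVec_nonneg ?_ fun v => ?_
  · have h1 : Tendsto (fun N => (A N)ᴴ) atTop (𝓝 Sᴴ) :=
      ((continuous_id.matrix_conjTranspose).tendsto S).comp h
    have h2 : (fun N => (A N)ᴴ) = A := funext fun N => (hA N).isHermitian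
    rw [h2] at h1
    exact tendsto_nhds_unique h1 h
  · have hc : Continuous fun M : Matrix n n ℂ => star v ⬝ᵥ (M *ᵥ v) := by fun_prop
    exact ge_of_tendsto' ((hc.tendsto S).comp h) fun N => (hA N).dotProduct_mulVec_nonneg v

section Spectrum

variable {ℙ : Measure Ω} {x : ℤ → Ω → ℂ} {P : ℕ}

/-- Periodicity leaves only `P` distinct rows, so the sum of their norms dominates all of them. -/
lemma IsCyclostationary.exists_summable_bound (hx : IsCyclostationary ℙ x P)
    (hsum : ∀ n : ℤ, Summable fun m : ℤ => ‖autocorr ℙ x n m‖) :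
    ∃ ρ : ℤ → ℝ, Summable ρ ∧ ∀ n m, ‖autocorr ℙ x n m‖ ≤ ρ m := by
  refine ⟨fun m => ∑ n ∈ Finset.range P, ‖autocorr ℙ x n m‖, summable_sum fun n _ => hsum n,
    fun n m => ?_⟩
  have hPz : (0 : ℤ) < P := by exact_mod_cast hx.period_pos
  have h0 := Int.emod_nonneg n hPz.ne'
  have h1 : ((n % P).toNat : ℤ) = n % P := Int.toNat_of_nonneg h0
  have h2 : autocorr ℙ x n m = autocorr ℙ x (n % P) m := by
    conv_lhs => rw [← Int.emod_add_mul_ediv n P, mul_comm (P : ℤ) _, hx.periodic]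
  rw [h2, ← h1]
  refine Finset.single_le_sum (f := fun k : ℕ => ‖autocorr ℙ x k m‖) (fun _ _ => norm_nonneg _) ?_
  rw [Finset.mem_range]
  have := Int.emod_lt_of_pos n hPz
  omega

lemma inner_toLp_eq_autocorr (h2 : ∀ n, MemLp (x n) 2 ℙ) (l k : ℤ) :
    inner ℂ ((h2 l).toLp (x l)) ((h2 k).toLp (x k)) = autocorr ℙ x l (k - l) := by
  rw [L2.inner_def, autocorr, add_sub_cancel]
  refine integral_congr_ae ?_
  filter_upwards [(h2 l).coeFn_toLp, (h2 k).coeFn_toLp] with ω h1 h2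
  rw [h1, h2, RCLike.inner_apply]

/-- The correlation matrix of the finite Fourier sums of the process. -/
lemma posSemidef_truncated_gram (h2 : ∀ n, MemLp (x n) 2 ℙ) (σ : ℝ) (T : ℕ) :
    (Matrix.of fun r c : Fin P => ∑ l ∈ Finset.range T, ∑ k ∈ Finset.range T,
      autocorr ℙ x l (k - l) * (conj (expo (σ + ((r : ℕ) : ℝ) / P) k) *
        expo (σ + ((c : ℕ) : ℝ) / P) l)).PosSemidef := by
  -- The inner product is conjugate-linear on the left, so the wanted matrix is the transpose of the
  -- Gram matrix.
  have h := (Matrix.posSemidef_gram ℂ (fun c : Fin P => ∑ l ∈ Finset.range T,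
    conj (expo (σ + ((c : ℕ) : ℝ) / P) l) • (h2 l).toLp (x l))).transpose
  refine Eq.mp (congrArg Matrix.PosSemidef ?_) h
  ext r c
  simp only [Matrix.of_apply, Matrix.transpose_apply, Matrix.gram, sum_inner, inner_sum,
    inner_smul_left, inner_smul_right, inner_toLp_eq_autocorr, Complex.conj_conj,
    Finset.mul_sum]
  rw [Finset.sum_comm]
  refine Finset.sum_congr rfl fun l _ => Finset.sum_congr rfl fun k _ => ?_
  ring

/-- Reindexing by the lag `m = k - l` gives a series to which dominated convergence applies. -/
lemma hasSum_truncated_gram (e : ℤ → ℤ → ℂ) (T : ℕ) :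
    HasSum (fun m : ℤ => ∑ n ∈ Finset.range T,
      if 0 ≤ (n : ℤ) + m ∧ (n : ℤ) + m < T then autocorr ℙ x n m * e (n + m) n else 0)
      (∑ l ∈ Finset.range T, ∑ k ∈ Finset.range T, autocorr ℙ x l (k - l) * e k l) := by
  refine hasSum_sum fun l _ => ?_
  rw [← (Equiv.subRight (l : ℤ)).hasSum_iff]
  simp only [Function.comp_def, Equiv.subRight_apply, add_sub_cancel]
  set f : ℤ → ℂ := fun k => if 0 ≤ k ∧ k < T then autocorr ℙ x l (k - l) * e k l else 0 with hf
  have h : HasSum f (∑ k ∈ (Finset.range T).map Nat.castEmbedding, f k) :=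
    hasSum_sum_of_ne_finset_zero (by
      intro k hk
      refine if_neg ?_
      rintro ⟨h0, h1⟩
      exact hk (Finset.mem_map.2 ⟨k.toNat, by rw [Finset.mem_range]; omega,
        by simpa using h0⟩))
  convert h using 1
  rw [Finset.sum_map]
  refine Finset.sum_congr rfl fun k hk => ?_
  rw [Finset.mem_range] at hk
  simp [hf, hk]

theorem posSemidef_cyclicPSD (hx : IsCyclostationary ℙ x P)
    (hsum : ∀ n : ℤ, Summable fun m : ℤ => ‖autocorr ℙ x n m‖) (σ : ℝ) :
    (cyclicPSD ℙ x P σ).PosSemidef := by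
  obtain ⟨ρ, hρ, hle⟩ := hx.exists_summable_bound hsum
  have hP := hx.period_pos
  have hmat := fun N : ℕ => (posSemidef_truncated_gram (P := P) hx.second_order σ
    ((N + 1) * P)).smul (a := (1 / (((N + 1) * P : ℕ) : ℂ))) (by
      rw [one_div, inv_nonneg]; exact Nat.cast_nonneg _)
  refine posSemidef_of_tendsto hmat ?_
  refine tendsto_pi_nhds.2 fun r => tendsto_pi_nhds.2 fun c => ?_
  set G : ℤ → ℤ → ℂ := fun m n => autocorr ℙ x n m *
      (conj (expo (σ + ((r : ℕ) : ℝ) / P) (n + m)) * expo (σ + ((c : ℕ) : ℝ) / P) n) with hG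
  have hGn : ∀ m n, ‖G m n‖ ≤ ρ m := fun m n => by simpa [hG, norm_expo] using hle n m
  have hGp : ∀ m n l : ℤ, G m (n + l * P) = G m n := by
    intro m n l
    have h1 : conj (expo (σ + ((r : ℕ) : ℝ) / P) (n + l * P + m)) *
        expo (σ + ((c : ℕ) : ℝ) / P) (n + l * P) =
        conj (expo (((r : ℕ) : ℝ) / P) (l * P)) * expo (((c : ℕ) : ℝ) / P) (l * P) *
        (conj (expo (σ + ((r : ℕ) : ℝ) / P) (n + m)) * expo (σ + ((c : ℕ) : ℝ) / P) n) := by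
      rw [conj_expo, conj_expo, conj_expo]
      simp only [expo, ← Complex.exp_add]
      congr 1; push_cast; ring
    have hr := expo_div_mul hP (r : ℕ) l
    have hc := expo_div_mul hP (c : ℕ) l
    push_cast at hr hc
    simp only [hG]
    rw [hx.periodic, h1, hr, hc]
    simp
  -- For each lag the windowed average tends to the mean over a period, and `ρ` dominates uniformly
  -- in the window length.
  have key : Tendsto (fun N : ℕ => ∑' m : ℤ, (1 / (((N + 1) * P : ℕ) : ℂ)) *
      ∑ n ∈ Finset.range ((N + 1) * P),
      if 0 ≤ (n : ℤ) + m ∧ (n : ℤ) + m < ((N + 1) * P : ℕ) then G m n else 0) atTop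
      (𝓝 (∑' m : ℤ, (1 / (P : ℂ)) * ∑ n ∈ Finset.range P, G m n)) := by
    refine tendsto_tsum_of_dominated_convergence hρ
      (fun m => tendsto_truncated_average hP (G m) (hGp m) (hGn m) m)
      (Eventually.of_forall fun N m => ?_)
    have hT : (0 : ℝ) < ((N + 1) * P : ℕ) := by exact_mod_cast Nat.mul_pos N.succ_pos hP
    have h0 : 0 ≤ ρ m := (norm_nonneg _).trans (hGn m 0)
    rw [norm_mul, norm_div, norm_one, Complex.norm_natCast]
    have : ‖∑ n ∈ Finset.range ((N + 1) * P),
      if 0 ≤ (n : ℤ) + m ∧ (n : ℤ) + m < ((N + 1) * P : ℕ) then G m n else 0‖ ≤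
        ((N + 1) * P : ℕ) * ρ m := by
      refine (norm_sum_le_of_le (f := fun n : ℕ => if 0 ≤ (n : ℤ) + m ∧
        (n : ℤ) + m < ((N + 1) * P : ℕ) then G m n else 0) (n := fun _ => ρ m) _
        fun n _ => ?_).trans_eq (by simp)
      split_ifs
      · exact hGn m n
      · simpa using h0
    calc _ ≤ 1 / (((N + 1) * P : ℕ) : ℝ) * (((N + 1) * P : ℕ) * ρ m) := by gcongr
      _ = ρ m := by field_simp
  convert key using 1
  · ext N
    rw [tsum_mul_left, (hasSum_truncated_gram (ℙ := ℙ) (x := x) (fun k l =>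
      conj (expo (σ + ((r : ℕ) : ℝ) / P) k) * expo (σ + ((c : ℕ) : ℝ) / P) l)
      ((N + 1) * P)).tsum_eq]
    rfl
  · congr 1
    rw [cyclicPSD_apply, tsum_mul_left, Summable.tsum_finsetSum]
    intro n _
    refine Summable.of_norm_bounded hρ fun m => hGn m n

lemma norm_cyclicPSD_apply_le (hx : IsCyclostationary ℙ x P)
    (hsum : ∀ n : ℤ, Summable fun m : ℤ => ‖autocorr ℙ x n m‖) :
    ∃ C : ℝ, ∀ σ r c, ‖cyclicPSD ℙ x P σ r c‖ ≤ C := by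
  obtain ⟨ρ, hρ, hle⟩ := hx.exists_summable_bound hsum
  refine ⟨‖(1 / (P : ℂ))‖ * ∑ n ∈ Finset.range P, ∑' m, ρ m, fun σ r c => ?_⟩
  rw [cyclicPSD_apply, norm_mul]
  gcongr
  refine norm_sum_le_of_le _ fun n _ => tsum_of_norm_bounded hρ.hasSum fun m => ?_
  simpa [norm_expo] using hle n m

/-- The series converges uniformly in `σ`. Continuity supplies the measurability used for the
spectrum and for the selection of eigenvectors. -/
lemma continuous_cyclicPSD (hx : IsCyclostationary ℙ x P)
    (hsum : ∀ n : ℤ, Summable fun m : ℤ => ‖autocorr ℙ x n m‖) (r c : Fin P) :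
    Continuous fun σ => cyclicPSD ℙ x P σ r c := by
  obtain ⟨ρ, hρ, hle⟩ := hx.exists_summable_bound hsum
  simp_rw [cyclicPSD_apply]
  refine continuous_const.mul (continuous_finsetSum _ fun n _ => ?_)
  refine continuous_tsum (fun m => ?_) hρ fun m σ => by simpa [norm_expo] using hle n m
  simp_rw [conj_expo, expo]
  fun_prop

end Spectrum

/-! ### Folding `[0, 1)` onto the sub-band `[0, 1/P)`. -/

instance : IsFiniteMeasure unitBand := inferInstanceAs (IsFiniteMeasure (volume.restrict _))

/-- Lebesgue measure on `[0, 1/P)`. -/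
abbrev subBand (P : ℕ) : Measure ℝ := volume.restrict (Ico (0 : ℝ) (1 / (P : ℝ)))

lemma Ico_eq_iUnion_subBand {P : ℕ} (hP : 0 < P) :
    Ico (0 : ℝ) 1 = ⋃ p : Fin P, Ico (((p : ℕ) : ℝ) / P) (((p : ℕ) : ℝ) / P + 1 / P) := by
  have hPr : (0 : ℝ) < P := by exact_mod_cast hP
  ext y
  simp only [mem_Ico, mem_iUnion]
  constructor
  · rintro ⟨h0, h1⟩
    have hy : 0 ≤ y * P := by positivity
    have hlt : ⌊y * P⌋₊ < P := by
      rw [Nat.floor_lt hy]; nlinarith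
    refine ⟨⟨⌊y * P⌋₊, hlt⟩, ?_, ?_⟩
    · rw [div_le_iff₀ hPr]; exact Nat.floor_le hy
    · rw [← add_div, lt_div_iff₀ hPr]; exact Nat.lt_floor_add_one _
  · rintro ⟨p, h0, h1⟩
    have hp : ((p : ℕ) : ℝ) + 1 ≤ P := by exact_mod_cast p.2
    refine ⟨(by positivity : (0 : ℝ) ≤ ((p : ℕ) : ℝ) / P).trans h0, h1.trans_le ?_⟩
    rw [← add_div, div_le_one hPr]; exact hp

lemma disjoint_subBand {P : ℕ} (hP : 0 < P) : Pairwise (Function.onFun Disjoint fun p : Fin P =>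
    Ico (((p : ℕ) : ℝ) / P) (((p : ℕ) : ℝ) / P + 1 / P)) := by
  have hPr : (0 : ℝ) < P := by exact_mod_cast hP
  intro p q hpq
  rw [Function.onFun, Set.disjoint_left]
  rintro y ⟨h1, h2⟩ ⟨h3, h4⟩
  rw [div_le_iff₀ hPr] at h1 h3
  rw [← add_div, lt_div_iff₀ hPr] at h2 h4
  have h5 : ((p : ℕ) : ℝ) < (q : ℕ) + 1 := h1.trans_lt h4
  have h6 : ((q : ℕ) : ℝ) < (p : ℕ) + 1 := h3.trans_lt h2
  have h7 : (p : ℕ) < (q : ℕ) + 1 := by exact_mod_cast h5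
  have h8 : (q : ℕ) < (p : ℕ) + 1 := by exact_mod_cast h6
  apply hpq; ext; omega

lemma unitBand_eq_sum {P : ℕ} (hP : 0 < P) :
    unitBand = Measure.sum fun p : Fin P =>
      (subBand P).map fun σ => σ + ((p : ℕ) : ℝ) / (P : ℝ) := by
  rw [unitBand, Ico_eq_iUnion_subBand hP, Measure.restrict_iUnion (disjoint_subBand hP)
    fun p => measurableSet_Ico]
  congr 1
  ext1 p
  have h := (measurePreserving_add_right (volume : Measure ℝ)
    (((p : ℕ) : ℝ) / (P : ℝ))).restrict_preimage
    (s := Ico (((p : ℕ) : ℝ) / P) (((p : ℕ) : ℝ) / P + 1 / P)) measurableSet_Ico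
  rw [← h.map_eq, Set.preimage_add_const_Ico]
  simp [subBand]

lemma ae_unitBand_iff {P : ℕ} (hP : 0 < P) {Q : ℝ → Prop} :
    (∀ᵐ y ∂unitBand, Q y) ↔
      ∀ᵐ σ ∂subBand P, ∀ p : Fin P, Q (σ + ((p : ℕ) : ℝ) / (P : ℝ)) := by
  rw [unitBand_eq_sum hP, Measure.ae_sum_iff, ae_all_iff]
  exact forall_congr' fun p => (measurableEmbedding_addRight _).ae_map_iff

lemma aestronglyMeasurable_unitBand_iff {P : ℕ} (hP : 0 < P) {E : Type*} [TopologicalSpace E]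
    [TopologicalSpace.PseudoMetrizableSpace E] {f : ℝ → E} :
    AEStronglyMeasurable f unitBand ↔
      ∀ p : Fin P, AEStronglyMeasurable (fun σ => f (σ + ((p : ℕ) : ℝ) / (P : ℝ))) (subBand P) := by
  rw [unitBand_eq_sum hP, aestronglyMeasurable_sum_measure_iff]
  exact forall_congr' fun p => (measurableEmbedding_addRight _).aestronglyMeasurable_map_iff

lemma integrable_unitBand_iff {P : ℕ} (hP : 0 < P) {E : Type*} [NormedAddCommGroup E]
    {f : ℝ → E} :
    Integrable f unitBand ↔
      ∀ p : Fin P, Integrable (fun σ => f (σ + ((p : ℕ) : ℝ) / (P : ℝ))) (subBand P) := by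
  rw [unitBand_eq_sum hP, Measure.sum_fintype, integrable_finsetSum_measure]
  simp only [Finset.mem_univ, true_imp_iff]
  exact forall_congr' fun p => (measurableEmbedding_addRight _).integrable_map_iff

lemma integral_unitBand {P : ℕ} (hP : 0 < P) {f : ℝ → ℂ} (hf : Integrable f unitBand) :
    ∫ y, f y ∂unitBand = ∫ σ, ∑ p : Fin P, f (σ + ((p : ℕ) : ℝ) / (P : ℝ)) ∂subBand P := by
  have h := (integrable_unitBand_iff hP).1 hf
  rw [integral_finsetSum _ fun p _ => h p]
  rw [unitBand_eq_sum hP, Measure.sum_fintype, integrable_finsetSum_measure] at hf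
  rw [unitBand_eq_sum hP, Measure.sum_fintype, integral_finsetSum_measure hf]
  exact Finset.sum_congr rfl fun p _ => (measurableEmbedding_addRight _).integral_map _

/-! ### Uniqueness of Fourier coefficients. -/

/-- An integrable function on a period is determined by its Fourier coefficients. -/
theorem ae_eq_zero_of_fourier_eq_zero {T : ℝ} (hT : 0 < T) {f : ℝ → ℂ}
    (hf : Integrable f (volume.restrict (Ico 0 T)))
    (h : ∀ t : ℤ, ∫ σ in Ico 0 T, f σ * fourier t (σ : AddCircle T) = 0) :
    ∀ᵐ σ ∂(volume.restrict (Ico 0 T)), f σ = 0 := by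
  have : Fact (0 < T) := ⟨hT⟩
  have hint : ∀ g : C(AddCircle T, ℂ),
      Integrable (fun σ : ℝ => f σ * g (σ : AddCircle T)) (volume.restrict (Ico 0 T)) := fun g =>
    hf.mul_bdd (c := ‖g‖) (g.continuous.comp (AddCircle.continuous_mk' T)).aestronglyMeasurable
      (Eventually.of_forall fun σ => g.norm_coe_le_norm _)
  -- Integration against `f` is a bounded functional whose closed kernel contains the Fourier
  -- monomials. Their span is dense, so the functional is zero.
  let L : C(AddCircle T, ℂ) →ₗ[ℂ] ℂ :=
    { toFun := fun g => ∫ σ in Ico 0 T, f σ * g (σ : AddCircle T)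
      map_add' := fun g g' => by
        rw [← integral_add (hint g) (hint g')]
        simp [mul_add]
      map_smul' := fun c g => by
        simp only [ContinuousMap.coe_smul, Pi.smul_apply, smul_eq_mul, RingHom.id_apply]
        rw [← integral_const_mul]
        congr 1; ext σ; ring }
  let Lc : C(AddCircle T, ℂ) →L[ℂ] ℂ := L.mkContinuous (∫ σ in Ico 0 T, ‖f σ‖) fun g => by
    refine (norm_integral_le_integral_norm _).trans ?_
    rw [← integral_mul_const]
    refine integral_mono (hint g).norm (hf.norm.mul_const _) fun σ => ?_
    simp only [norm_mul]
    exact mul_le_mul_of_nonneg_left (g.norm_coe_le_norm _) (norm_nonneg _)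
  have hker : ∀ g : C(AddCircle T, ℂ), ∫ σ in Ico 0 T, f σ * g (σ : AddCircle T) = 0 := by
    have hle : (Submodule.span ℂ (range <| @fourier T)).topologicalClosure ≤
        LinearMap.ker Lc.toLinearMap := by
      refine Submodule.topologicalClosure_minimal _ ?_ Lc.isClosed_ker
      rw [Submodule.span_le]
      rintro _ ⟨t, rfl⟩
      exact h t
    rw [span_fourier_closure_eq_top] at hle
    intro g
    exact hle (Submodule.mem_top (x := g))
  -- Test functions supported in the open interval vanish at both endpoints, so they descend to
  -- continuous functions on the circle.
  have hIoo : ∀ᵐ σ, σ ∈ Ioo 0 T → f σ = 0 := by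
    refine isOpen_Ioo.ae_eq_zero_of_integral_contDiff_smul_eq_zero
      (IntegrableOn.locallyIntegrableOn (IntegrableOn.mono_set hf Ioo_subset_Ico_self))
      fun g hg _ hsupp => ?_
    have hz : ∀ y, y ∉ Ioo 0 T → g y = 0 := fun y hy =>
      image_eq_zero_of_notMem_tsupport fun hy' => hy (hsupp hy')
    let G : C(AddCircle T, ℂ) := ⟨AddCircle.liftIco T 0 fun y => (g y : ℂ),
      AddCircle.liftIco_zero_continuous (by
        rw [hz 0 (by simp), hz T (by simp)])
        (Complex.continuous_ofReal.comp hg.continuous).continuousOn⟩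
    rw [← setIntegral_eq_integral_of_forall_compl_eq_zero (s := Ico 0 T), ← hker G]
    · refine setIntegral_congr_fun measurableSet_Ico fun σ hσ => ?_
      have : G (σ : AddCircle T) = (g σ : ℂ) :=
        AddCircle.liftIco_zero_coe_apply (f := fun y => (g y : ℂ)) hσ
      simp only [this, Complex.real_smul]
      ring
    · intro y hy
      rw [hz y fun h => hy (Ioo_subset_Ico_self h), zero_smul]
  rw [ae_restrict_congr_set Ioo_ae_eq_Ico.symm]
  exact (ae_restrict_iff' measurableSet_Ioo).2 hIoo

lemma integral_unitBand_expo_mul_conj (n n' : ℤ) :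
    ∫ y, expo y n * conj (expo y n') ∂unitBand = if n = n' then 1 else 0 := by
  have h1 : ∀ y : ℝ, expo y n * conj (expo y n') =
      Complex.exp ((2 * Real.pi * Complex.I * ((n - n' : ℤ) : ℂ)) * (y : ℂ)) := fun y => by
    rw [conj_expo, ← expo_add_int, expo]
    congr 1; push_cast; ring
  simp_rw [h1]
  rw [unitBand, integral_Ico_eq_integral_Ioc, ← intervalIntegral.integral_of_le zero_le_one]
  split_ifs with h
  · simp [h]
  · have hne : (2 * Real.pi * Complex.I * ((n - n' : ℤ) : ℂ)) ≠ 0 :=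
      mul_ne_zero Complex.two_pi_I_ne_zero (by exact_mod_cast sub_ne_zero.2 h)
    rw [integral_exp_mul_complex hne]
    have h2 : Complex.exp (2 * Real.pi * Complex.I * ((n - n' : ℤ) : ℂ) * ((1 : ℝ) : ℂ)) = 1 := by
      rw [← Complex.exp_int_mul_two_pi_mul_I (n - n')]
      congr 1; push_cast; ring
    rw [h2]; simp

lemma continuous_expo (n : ℤ) : Continuous fun σ => expo σ n := by
  simp only [expo]; fun_prop

/-- The frequencies `σ + q/P` tile `[0, 1)` as `σ` runs over the sub-band. -/
lemma integral_sum_expo_mul_conj {P : ℕ} (hP : 0 < P) (n n' : ℤ) :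
    ∫ σ, ∑ q : Fin P, expo (σ + ((q : ℕ) : ℝ) / P) n * conj (expo (σ + ((q : ℕ) : ℝ) / P) n')
      ∂subBand P = if n = n' then 1 else 0 := by
  rw [← integral_unitBand_expo_mul_conj, integral_unitBand hP]
  refine Integrable.of_bound (C := 1) (Continuous.aestronglyMeasurable ?_)
    (Eventually.of_forall fun y => by simp [norm_expo])
  exact (continuous_expo n).mul (Complex.continuous_conj.comp (continuous_expo n'))

lemma expo_mul_eq_fourier {P : ℕ} (t : ℤ) (σ : ℝ) :
    expo σ (t * P) = fourier t (σ : AddCircle (1 / (P : ℝ))) := by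
  rw [fourier_coe_apply, expo]
  congr 1; push_cast; rw [one_div, div_inv_eq_mul]; ring

/-- If all the integrals of the functions `n ↦ csFun (d σ) σ n` vanish, then so do the
coefficients. -/
theorem ae_eq_zero_of_integral_csFun_eq_zero {P : ℕ} (hP : 0 < P) {d : ℝ → Fin P → ℂ}
    (hd : ∀ q, Integrable (fun σ => d σ q) (subBand P))
    (h : ∀ n : ℤ, ∫ σ, csFun (d σ) σ n ∂subBand P = 0) : ∀ᵐ σ ∂subBand P, d σ = 0 := by
  have hint : ∀ n : ℤ, Integrable (fun σ => csFun (d σ) σ n) (subBand P) := by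
    intro n
    refine integrable_finsetSum _ fun q _ => (hd q).mul_bdd (c := 1) ?_
      (Eventually.of_forall fun σ => (norm_expo _ _).le)
    exact ((continuous_expo n).comp (by fun_prop)).aestronglyMeasurable
  have h1 : ∀ n : ℤ, ∀ᵐ σ ∂subBand P, csFun (d σ) σ n = 0 := by
    intro n
    refine ae_eq_zero_of_fourier_eq_zero (by positivity) (hint n) fun t => ?_
    -- Shifting `n` by `t * P` multiplies the integrand by the `t`-th Fourier monomial of period
    -- `1/P`, so the hypothesis covers every Fourier coefficient.
    rw [← h (n + t * P)]
    congr 1; ext σ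
    rw [← expo_mul_eq_fourier, csFun_add_mul, mul_comm]
  filter_upwards [ae_all_iff.2 h1] with σ hσ
  exact csFun_injective σ fun n => by rw [hσ n, csFun_zero]; rfl

/-! ### Orthonormal coefficient vectors and the families they generate. -/

lemma orthonormal_toLp_iff {P : ℕ} (v : Fin P → Fin P → ℂ) :
    Orthonormal ℂ (fun p => (WithLp.toLp 2 (v p) : EuclideanSpace ℂ (Fin P))) ↔
      ∀ p p', ∑ q, v p q * conj (v p' q) = if p = p' then 1 else 0 := by
  rw [orthonormal_iff_ite, forall_comm]
  simp [PiLp.inner_apply, eq_comm]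

/-- A one-sided inverse of a square matrix is two-sided, so orthonormal rows and orthonormal columns
are equivalent. -/
lemma orthonormal_toLp_iff_columns {P : ℕ} (v : Fin P → Fin P → ℂ) :
    Orthonormal ℂ (fun p => (WithLp.toLp 2 (v p) : EuclideanSpace ℂ (Fin P))) ↔
      ∀ q q', ∑ p, conj (v p q) * v p q' = if q = q' then 1 else 0 := by
  rw [orthonormal_toLp_iff]
  have h1 : (∀ p p', ∑ q, v p q * conj (v p' q) = if p = p' then 1 else 0) ↔
      Matrix.of v * (Matrix.of v)ᴴ = 1 := by
    rw [← Matrix.ext_iff]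
    simp [Matrix.mul_apply, Matrix.one_apply]
  have h2 : (∀ q q', ∑ p, conj (v p q) * v p q' = if q = q' then 1 else 0) ↔
      (Matrix.of v)ᴴ * Matrix.of v = 1 := by
    rw [← Matrix.ext_iff]
    simp [Matrix.mul_apply, Matrix.one_apply]
  rw [h1, h2, mul_eq_one_comm]

lemma norm_le_one_of_orthonormal {P : ℕ} {v : Fin P → Fin P → ℂ}
    (h : Orthonormal ℂ (fun p => (WithLp.toLp 2 (v p) : EuclideanSpace ℂ (Fin P)))) (p q : Fin P) :
    ‖v p q‖ ≤ 1 := by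
  have := PiLp.norm_apply_le (WithLp.toLp 2 (v p) : EuclideanSpace ℂ (Fin P)) q
  rwa [h.1 p] at this

/-- Column orthonormality collapses the double sum over frequencies to its diagonal: the kernel is
invariant under unitary changes of basis. -/
lemma sum_csFun_mul_conj {P : ℕ} {v : Fin P → Fin P → ℂ}
    (h : Orthonormal ℂ (fun p => (WithLp.toLp 2 (v p) : EuclideanSpace ℂ (Fin P))))
    (σ : ℝ) (n n' : ℤ) :
    ∑ p, csFun (v p) σ n * conj (csFun (v p) σ n') =
      ∑ q : Fin P, expo (σ + ((q : ℕ) : ℝ) / P) n * conj (expo (σ + ((q : ℕ) : ℝ) / P) n') := by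
  rw [orthonormal_toLp_iff_columns] at h
  simp only [csFun, map_sum, map_mul, Finset.sum_mul_sum]
  rw [Finset.sum_comm]
  refine Finset.sum_congr rfl fun q _ => ?_
  rw [Finset.sum_comm]
  have h1 : ∀ q' : Fin P, ∑ p, v p q * expo (σ + ((q : ℕ) : ℝ) / P) n *
      (conj (v p q') * conj (expo (σ + ((q' : ℕ) : ℝ) / P) n')) =
      (∑ p, conj (v p q') * v p q) * (expo (σ + ((q : ℕ) : ℝ) / P) n *
        conj (expo (σ + ((q' : ℕ) : ℝ) / P) n')) := fun q' => by
    rw [Finset.sum_mul]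
    exact Finset.sum_congr rfl fun p _ => by ring
  simp_rw [h1, h]
  simp

section Family

variable {P : ℕ} {φ : ℤ → ℝ → ℂ} {b : Fin P → ℝ → Fin P → ℂ}

lemma HasCSForm.ae_eq (h : HasCSForm P φ b) (p : Fin P) (n : ℤ) :
    (fun σ => φ n (σ + ((p : ℕ) : ℝ) / (P : ℝ))) =ᵐ[subBand P] fun σ => csFun (b p σ) σ n := by
  filter_upwards [ae_restrict_mem measurableSet_Ico] with σ hσ
  exact h p σ hσ n

lemma memLp_two_unitBand_iff (hP : 0 < P) {f : ℝ → ℂ} :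
    MemLp f 2 unitBand ↔
      ∀ p : Fin P, MemLp (fun σ => f (σ + ((p : ℕ) : ℝ) / (P : ℝ))) 2 (subBand P) := by
  constructor
  · intro h p
    have h1 := (aestronglyMeasurable_unitBand_iff hP).1 h.1 p
    rw [memLp_two_iff_integrable_sq_norm h1]
    exact (integrable_unitBand_iff hP).1 ((memLp_two_iff_integrable_sq_norm h.1).1 h) p
  · intro h
    have h1 := (aestronglyMeasurable_unitBand_iff hP).2 fun p => (h p).1
    rw [memLp_two_iff_integrable_sq_norm h1, integrable_unitBand_iff hP]
    exact fun p => (memLp_two_iff_integrable_sq_norm (h p).1).1 (h p)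

/-- By `csFun_inversion` each coefficient is a finite combination of samples of `φ` with unimodular
factors. -/
lemma HasCSForm.memLp_coeff (hP : 0 < P) (h : HasCSForm P φ b) (hφ : ∀ n, MemLp (φ n) 2 unitBand)
    (p q : Fin P) : MemLp (fun σ => b p σ q) 2 (subBand P) := by
  have h1 : (fun σ => b p σ q) = fun σ => (1 / (P : ℂ)) * ∑ n ∈ Finset.range P,
      csFun (b p σ) σ n * conj (expo (σ + ((q : ℕ) : ℝ) / P) n) :=
    funext fun σ => csFun_inversion (b p σ) σ q
  rw [h1]
  refine MemLp.const_mul (memLp_finsetSum (f := fun (n : ℕ) σ => csFun (b p σ) σ n *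
    conj (expo (σ + ((q : ℕ) : ℝ) / P) n)) _ fun n _ => ?_) _
  have h2 : MemLp (fun σ => csFun (b p σ) σ n) 2 (subBand P) :=
    (memLp_congr_ae (h.ae_eq p n)).1 ((memLp_two_unitBand_iff hP).1 (hφ n) p)
  have hc : Continuous fun σ : ℝ => conj (expo (σ + ((q : ℕ) : ℝ) / P) n) :=
    Complex.continuous_conj.comp ((continuous_expo n).comp (by fun_prop))
  refine MemLp.of_le h2 (h2.1.mul hc.aestronglyMeasurable) (Eventually.of_forall fun σ => ?_)
  simp [norm_expo]

lemma csFun_sum_mul {ι : Type*} [Fintype ι] (v : ι → Fin P → ℂ) (c : ι → ℂ) (σ : ℝ) (n : ℤ) :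
    csFun (fun q => ∑ p, v p q * c p) σ n = ∑ p, csFun (v p) σ n * c p := by
  simp only [csFun, Finset.sum_mul]
  rw [Finset.sum_comm]
  exact Finset.sum_congr rfl fun p _ => Finset.sum_congr rfl fun q _ => by ring

lemma csFun_sub (v w : Fin P → ℂ) (σ : ℝ) (n : ℤ) :
    csFun (v - w) σ n = csFun v σ n - csFun w σ n := by
  simp [csFun, sub_mul]

/-- A family of the given form is orthonormal in `L²[0, 1)` only if its coefficient vectors are
orthonormal. -/
theorem HasCSForm.orthonormal_coeff (hP : 0 < P) (h : HasCSForm P φ b)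
    (hφ : ∀ n, MemLp (φ n) 2 unitBand)
    (horth : ∀ n n' : ℤ, ∫ y, φ n y * conj (φ n' y) ∂unitBand = if n = n' then 1 else 0) :
    ∀ᵐ σ ∂subBand P,
      Orthonormal ℂ (fun p => (WithLp.toLp 2 (b p σ) : EuclideanSpace ℂ (Fin P))) := by
  have hcs : ∀ p n, MemLp (fun σ => csFun (b p σ) σ n) 2 (subBand P) := fun p n =>
    (memLp_congr_ae (h.ae_eq p n)).1 ((memLp_two_unitBand_iff hP).1 (hφ n) p)
  have hsq : ∀ {f g : ℝ → ℂ} {μ : Measure ℝ}, MemLp f 2 μ → MemLp g 2 μ →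
      Integrable (fun σ => f σ * conj (g σ)) μ := fun hf hg => hf.integrable_mul hg.star
  have hcont : ∀ (q : Fin P) n', Continuous fun σ : ℝ => expo (σ + ((q : ℕ) : ℝ) / P) n' :=
    fun q n' => (continuous_expo n').comp (by fun_prop)
  have hexpo : ∀ (q : Fin P) n', MemLp (fun σ : ℝ => expo (σ + ((q : ℕ) : ℝ) / P) n') 2
      (subBand P) := fun q n' =>
    MemLp.of_bound (hcont q n').aestronglyMeasurable 1
      (Eventually.of_forall fun σ => (norm_expo _ _).le)
  -- Applied to this vector, `csFun` gives at `n` the difference of the kernels of `φ` and of the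
  -- exponentials. Both integrate to `δ_{n - n'}`, so Fourier uniqueness makes the vector vanish.
  have key : ∀ n' : ℤ, ∀ᵐ σ ∂subBand P, ((fun q => ∑ p, b p σ q * conj (csFun (b p σ) σ n')) -
      fun q : Fin P => conj (expo (σ + ((q : ℕ) : ℝ) / P) n')) = 0 := by
    intro n'
    refine ae_eq_zero_of_integral_csFun_eq_zero hP (fun q => ?_) fun n => ?_
    · refine Integrable.sub (integrable_finsetSum _ fun p _ => ?_) ?_
      · exact hsq (h.memLp_coeff hP hφ p q) (hcs p n')
      · exact ((hexpo q n').star).integrable one_le_two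
    · have hI := hsq (hφ n) (hφ n')
      have h1 : ∫ σ, ∑ p : Fin P, csFun (b p σ) σ n * conj (csFun (b p σ) σ n') ∂subBand P =
          if n = n' then 1 else 0 := by
        rw [← horth n n', integral_unitBand hP hI]
        refine integral_congr_ae ?_
        filter_upwards [ae_restrict_mem measurableSet_Ico] with σ hσ
        exact Finset.sum_congr rfl fun p _ => by rw [h p σ hσ n, h p σ hσ n']
      have h2 := integral_sum_expo_mul_conj hP n n'
      have h3 : ∀ σ, csFun ((fun q => ∑ p, b p σ q * conj (csFun (b p σ) σ n')) -
          fun q : Fin P => conj (expo (σ + ((q : ℕ) : ℝ) / P) n')) σ n =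
          (∑ p : Fin P, csFun (b p σ) σ n * conj (csFun (b p σ) σ n')) -
          ∑ q : Fin P, expo (σ + ((q : ℕ) : ℝ) / P) n *
            conj (expo (σ + ((q : ℕ) : ℝ) / P) n') := by
        intro σ
        rw [csFun_sub, csFun_sum_mul]
        congr 1
        exact Finset.sum_congr rfl fun q _ => mul_comm _ _
      simp_rw [h3]
      rw [integral_sub, h1, h2, sub_self]
      · exact integrable_finsetSum _ fun p _ => hsq (hcs p n) (hcs p n')
      · exact integrable_finsetSum _ fun q _ => hsq (hexpo q n) (hexpo q n')
  filter_upwards [ae_all_iff.2 key] with σ hσ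
  rw [orthonormal_toLp_iff_columns]
  intro q
  -- The conjugated identities, one for each `n`, allow a second use of injectivity, which yields
  -- column orthonormality.
  have h1 : (fun q' => ∑ p, b p σ q' * conj (b p σ q)) = fun q' => if q' = q then (1 : ℂ) else 0 := by
    refine csFun_injective σ fun n => ?_
    have h2 := congrArg conj (sub_eq_zero.1 (congrFun (hσ n) q))
    simp only [map_sum, map_mul, Complex.conj_conj] at h2
    rw [csFun_sum_mul]
    simp only [csFun, ite_mul, one_mul, zero_mul, Finset.sum_ite_eq', Finset.mem_univ, if_true]
    rw [← h2]
    exact Finset.sum_congr rfl fun p _ => mul_comm _ _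
  intro q'
  have h2 := congrFun h1 q'
  simp_rw [mul_comm (conj (b _ σ q)), h2, eq_comm]

/-- A family of the given form with orthonormal coefficient vectors is total in `L²[0, 1)`. -/
theorem HasCSForm.ae_eq_zero_of_integral_eq_zero (hP : 0 < P) (h : HasCSForm P φ b)
    (hb : ∀ p, AEMeasurable (b p) (subBand P))
    (horth : ∀ᵐ σ ∂subBand P,
      Orthonormal ℂ (fun p => (WithLp.toLp 2 (b p σ) : EuclideanSpace ℂ (Fin P))))
    (hφ : ∀ n, MemLp (φ n) 2 unitBand)
    {f : ℝ → ℂ} (hf : MemLp f 2 unitBand) (h0 : ∀ n, ∫ y, conj (φ n y) * f y ∂unitBand = 0) :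
    ∀ᵐ y ∂unitBand, f y = 0 := by
  have hfp := fun p => ((memLp_two_unitBand_iff hP).1 hf p).integrable one_le_two
  -- Applied to this vector, `csFun` at `n` integrates to the conjugate of the `n`-th coefficient of
  -- `f`, which is zero.
  have key : ∀ᵐ σ ∂subBand P,
      (fun q => ∑ p : Fin P, b p σ q * conj (f (σ + ((p : ℕ) : ℝ) / (P : ℝ)))) = 0 := by
    refine ae_eq_zero_of_integral_csFun_eq_zero hP (fun q => ?_) fun n => ?_
    · refine integrable_finsetSum _ fun p _ => ?_
      have h1 : Integrable (fun σ => conj (f (σ + ((p : ℕ) : ℝ) / (P : ℝ)))) (subBand P) :=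
        (LinearIsometryEquiv.integrable_comp_iff (Complex.conjLIE)).2 (hfp p)
      refine h1.bdd_mul (c := 1)
        ((measurable_pi_apply q).comp_aemeasurable (hb p)).aestronglyMeasurable ?_
      filter_upwards [horth] with σ hσ
      exact norm_le_one_of_orthonormal hσ p q
    · have hI : Integrable (fun y => conj (φ n y) * f y) unitBand :=
        (hφ n).star.integrable_mul hf
      have h1 := h0 n
      rw [integral_unitBand hP hI] at h1
      have h2 := congrArg conj h1
      rw [← integral_conj, map_zero] at h2
      rw [← h2]
      refine integral_congr_ae ?_
      filter_upwards [ae_restrict_mem measurableSet_Ico] with σ hσ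
      rw [csFun_sum_mul, map_sum]
      exact Finset.sum_congr rfl fun p _ => by rw [h p σ hσ n]; simp
  rw [ae_unitBand_iff hP]
  filter_upwards [key, horth] with σ hσ ho p
  rw [orthonormal_toLp_iff] at ho
  -- Pairing with `b p σ` isolates the single value `conj (f (σ + p/P))` by orthonormality.
  have h1 : ∑ q, conj (b p σ q) *
      (∑ p' : Fin P, b p' σ q * conj (f (σ + ((p' : ℕ) : ℝ) / (P : ℝ)))) = 0 :=
    Finset.sum_eq_zero fun q _ => by rw [show (∑ p' : Fin P, b p' σ q *
      conj (f (σ + ((p' : ℕ) : ℝ) / (P : ℝ)))) = 0 from congrFun hσ q, mul_zero]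
  simp_rw [Finset.mul_sum] at h1
  rw [Finset.sum_comm] at h1
  have h2 : ∀ p' : Fin P, ∑ q, conj (b p σ q) *
      (b p' σ q * conj (f (σ + ((p' : ℕ) : ℝ) / (P : ℝ)))) =
      (if p' = p then 1 else 0) * conj (f (σ + ((p' : ℕ) : ℝ) / (P : ℝ))) := fun p' => by
    rw [← ho p' p, Finset.sum_mul]
    exact Finset.sum_congr rfl fun q _ => by ring
  simp_rw [h2] at h1
  simpa using h1

end Family

/-! ### Hilbert space tools: completeness and isometries from Gram matrices. -/

/-- A total orthonormal sequence of square integrable functions satisfies the completeness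
relation. -/
theorem tendsto_eLpNorm_partial_sum {μ : Measure ℝ} {φ : ℤ → ℝ → ℂ} (hφ : ∀ n, MemLp (φ n) 2 μ)
    (horth : ∀ n n' : ℤ, ∫ y, φ n y * conj (φ n' y) ∂μ = if n = n' then 1 else 0)
    (htot : ∀ f : ℝ → ℂ, MemLp f 2 μ → (∀ n, ∫ y, conj (φ n y) * f y ∂μ = 0) →
      ∀ᵐ y ∂μ, f y = 0)
    {f : ℝ → ℂ} (hf : MemLp f 2 μ) :
    Tendsto (fun s : Finset ℤ => eLpNorm (fun y =>
      ∑ n ∈ s, φ n y * (∫ y', conj (φ n y') * f y' ∂μ) - f y) 2 μ) atTop (𝓝 0) := by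
  have hinner : ∀ n {g : ℝ → ℂ} (hg : MemLp g 2 μ),
      inner ℂ ((hφ n).toLp (φ n)) (hg.toLp g) = ∫ y, conj (φ n y) * g y ∂μ := by
    intro n g hg
    rw [L2.inner_def]
    refine integral_congr_ae ?_
    filter_upwards [(hφ n).coeFn_toLp, hg.coeFn_toLp] with y h1 h2
    rw [h1, h2, RCLike.inner_apply, mul_comm]
  have ho : Orthonormal ℂ fun n => (hφ n).toLp (φ n) := by
    rw [orthonormal_iff_ite]
    intro n n'
    rw [hinner]
    simp_rw [mul_comm (conj (φ n _)), horth n' n, eq_comm]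
  have hbot : (Submodule.span ℂ (Set.range fun n => (hφ n).toLp (φ n)))ᗮ = ⊥ := by
    rw [Submodule.eq_bot_iff]
    intro F hF
    have h1 : ∀ n, ∫ y, conj (φ n y) * F y ∂μ = 0 := fun n => by
      rw [← hinner n (Lp.memLp F), Lp.toLp_coeFn]
      exact (Submodule.mem_orthogonal _ _).1 hF _ (Submodule.subset_span ⟨n, rfl⟩)
    exact (Lp.eq_zero_iff_ae_eq_zero).2 (htot F (Lp.memLp F) h1)
  have hs := (HilbertBasis.mkOfOrthogonalEqBot ho hbot).hasSum_repr (hf.toLp f)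
  simp only [HilbertBasis.repr_apply_apply, HilbertBasis.coe_mkOfOrthogonalEqBot, hinner] at hs
  have h2 : Tendsto (fun s : Finset ℤ => ‖(∑ n ∈ s, (∫ y, conj (φ n y) * f y ∂μ) •
      (hφ n).toLp (φ n)) - hf.toLp f‖ₑ) atTop (𝓝 0) := by
    have := (hs.sub_const (hf.toLp f)).enorm
    simpa using this
  refine h2.congr fun s => ?_
  rw [Lp.enorm_def]
  refine eLpNorm_congr_ae ?_
  filter_upwards [Lp.coeFn_sub (∑ n ∈ s, (∫ y, conj (φ n y) * f y ∂μ) • (hφ n).toLp (φ n))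
      (hf.toLp f), Lp.coeFn_finsetSum s fun n => (∫ y, conj (φ n y) * f y ∂μ) • (hφ n).toLp (φ n),
    ae_all_iff.2 fun n => Lp.coeFn_smul (∫ y, conj (φ n y) * f y ∂μ) ((hφ n).toLp (φ n)),
    ae_all_iff.2 fun n => (hφ n).coeFn_toLp, hf.coeFn_toLp] with y h1 h2 h3 h4 h5
  rw [h1, Pi.sub_apply, h2, h5, Finset.sum_apply]
  congr 1
  refine Finset.sum_congr rfl fun n _ => ?_
  rw [h3 n, Pi.smul_apply, h4 n, smul_eq_mul, mul_comm]

lemma norm_linearCombination_eq {ι E F : Type*} [NormedAddCommGroup E] [InnerProductSpace ℂ E]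
    [NormedAddCommGroup F] [InnerProductSpace ℂ F] {v : ι → E} {w : ι → F}
    (h : ∀ i j, inner ℂ (v i) (v j) = inner ℂ (w i) (w j)) (c : ι →₀ ℂ) :
    ‖Finsupp.linearCombination ℂ v c‖ = ‖Finsupp.linearCombination ℂ w c‖ := by
  have h1 : inner ℂ (Finsupp.linearCombination ℂ v c) (Finsupp.linearCombination ℂ v c) =
      inner ℂ (Finsupp.linearCombination ℂ w c) (Finsupp.linearCombination ℂ w c) := by
    simp only [Finsupp.linearCombination_apply, Finsupp.sum, sum_inner, inner_sum,
      inner_smul_left, inner_smul_right, h]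
  rw [@norm_eq_sqrt_re_inner ℂ, @norm_eq_sqrt_re_inner ℂ _ _ _ _ (Finsupp.linearCombination ℂ w c),
    h1]

/-- Two families with the same Gram matrix, the first of them total, are related by a linear
isometry. -/
lemma exists_linearIsometry_of_inner_eq {ι E F : Type*} [NormedAddCommGroup E]
    [InnerProductSpace ℂ E] [CompleteSpace E] [NormedAddCommGroup F] [InnerProductSpace ℂ F]
    [CompleteSpace F] {v : ι → E} {w : ι → F}
    (h : ∀ i j, inner ℂ (v i) (v j) = inner ℂ (w i) (w j))
    (hv : (Submodule.span ℂ (Set.range v))ᗮ = ⊥) : ∃ V : E →ₗᵢ[ℂ] F, ∀ i, V (v i) = w i := by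
  have hd : DenseRange (Finsupp.linearCombination ℂ v) := by
    have h1 := Submodule.topologicalClosure_eq_top_iff.2 hv
    rw [← Finsupp.range_linearCombination, ← Submodule.dense_iff_topologicalClosure_eq_top] at h1
    exact h1
  -- Equality of norms makes the assignment `v i ↦ w i` well defined even when the `v i` are
  -- dependent, and lets it extend by density.
  have hn : ∀ c, ‖Finsupp.linearCombination ℂ w c‖ ≤ 1 * ‖Finsupp.linearCombination ℂ v c‖ :=
    fun c => by rw [one_mul, norm_linearCombination_eq h]
  have hV := LinearMap.extendOfNorm_eq (f := Finsupp.linearCombination ℂ w) hd ⟨1, hn⟩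
  set V := (Finsupp.linearCombination ℂ w).extendOfNorm (Finsupp.linearCombination ℂ v)
  have hiso : (fun u => ‖V u‖) = fun u => ‖u‖ := by
    refine hd.equalizer (by fun_prop) (by fun_prop) (funext fun c => ?_)
    simp only [Function.comp, hV, norm_linearCombination_eq h]
  refine ⟨⟨V.toLinearMap, fun u => congrFun hiso u⟩, fun i => ?_⟩
  have := hV (Finsupp.single i 1)
  simpa using this

/-! ### The space `L²(S dλ)`. -/

section SpectralMeasure

variable {S : ℝ → ℝ}

lemma spectralMeasure_absolutelyContinuous : spectralMeasure S ≪ unitBand :=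
  withDensity_absolutelyContinuous _ _

lemma isFiniteMeasure_spectralMeasure (hS : Integrable S unitBand) :
    IsFiniteMeasure (spectralMeasure S) :=
  isFiniteMeasure_withDensity_ofReal hS.2

lemma integral_spectralMeasure (hS : Integrable S unitBand) (h0 : ∀ᵐ y ∂unitBand, 0 ≤ S y)
    (g : ℝ → ℂ) : ∫ y, g y ∂spectralMeasure S = ∫ y, (S y : ℂ) * g y ∂unitBand := by
  rw [spectralMeasure, integral_withDensity_eq_integral_toReal_smul₀
    hS.1.aemeasurable.ennreal_ofReal (Eventually.of_forall fun _ => ENNReal.ofReal_lt_top)]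
  refine integral_congr_ae ?_
  filter_upwards [h0] with y hy
  rw [ENNReal.toReal_ofReal hy, Complex.real_smul]

lemma ae_mem_Ico_spectralMeasure : ∀ᵐ y ∂spectralMeasure S, y ∈ Ico (0 : ℝ) 1 :=
  spectralMeasure_absolutelyContinuous.ae_le (ae_restrict_mem measurableSet_Ico)

lemma spectralMeasure_real_eq (hS : Integrable S unitBand) (h0 : ∀ᵐ y ∂unitBand, 0 ≤ S y)
    {A : Set ℝ} (hA : MeasurableSet A) (hAs : A ⊆ Ico 0 1) :
    (spectralMeasure S).real A = ∫ y in A, S y := by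
  have h1 : unitBand.restrict A = volume.restrict A := Measure.restrict_restrict_of_subset hAs
  rw [← h1, integral_eq_lintegral_of_nonneg_ae (ae_restrict_of_ae h0) hS.1.restrict,
    measureReal_def, spectralMeasure, withDensity_apply _ hA]

/-- A function of `L²(S dy)` orthogonal to all `φ n` vanishes, if the `φ n` are total in
`L²[0, 1)`. -/
lemma ae_eq_zero_spectralMeasure {φ : ℤ → ℝ → ℂ} (hS : Integrable S unitBand)
    (h0 : ∀ᵐ y ∂unitBand, 0 ≤ S y) {M : ℝ} (hM : ∀ᵐ y ∂unitBand, ‖S y‖ ≤ M)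
    (htot : ∀ f : ℝ → ℂ, MemLp f 2 unitBand → (∀ n, ∫ y, conj (φ n y) * f y ∂unitBand = 0) →
      ∀ᵐ y ∂unitBand, f y = 0)
    {F : ℝ → ℂ} (hFm : StronglyMeasurable F) (hF : MemLp F 2 (spectralMeasure S))
    (horth : ∀ n, ∫ y, conj (φ n y) * F y ∂spectralMeasure S = 0) :
    ∀ᵐ y ∂spectralMeasure S, F y = 0 := by
  have hSm : AEStronglyMeasurable (fun y => (S y : ℂ)) unitBand :=
    Complex.continuous_ofReal.comp_aestronglyMeasurable hS.1
  -- Since `S` is bounded, `|S F|² ≤ M S |F|²` is integrable. Orthogonality of `F` in `L²(S)` is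
  -- then orthogonality of `S F` in `L²[0, 1)`.
  have hmem : MemLp (fun y => (S y : ℂ) * F y) 2 unitBand := by
    refine (memLp_two_iff_integrable_sq_norm (hSm.mul hFm.aestronglyMeasurable)).2 ?_
    have h1 := (memLp_two_iff_integrable_sq_norm hF.1).1 hF
    rw [spectralMeasure, integrable_withDensity_iff_integrable_smul₀'
      hS.1.aemeasurable.ennreal_ofReal (Eventually.of_forall fun _ => ENNReal.ofReal_lt_top)] at h1
    refine (h1.bdd_mul (c := M) hS.1 hM).congr ?_
    filter_upwards [h0] with y hy
    rw [ENNReal.toReal_ofReal hy, Pi.mul_apply, norm_mul, Complex.norm_real, Real.norm_of_nonneg hy, smul_eq_mul]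
    ring
  have hz := htot _ hmem fun n => by
    rw [← horth n, integral_spectralMeasure hS h0]
    congr 1; ext y; ring
  rw [spectralMeasure, ae_withDensity_iff' hS.1.aemeasurable.ennreal_ofReal]
  filter_upwards [hz, h0] with y hy hy0 hne
  rcases mul_eq_zero.1 hy with h | h
  · exfalso; apply hne
    rw [Complex.ofReal_eq_zero.1 h, ENNReal.ofReal_zero]
  · exact h

end SpectralMeasure

/-! ### Random measures from isometries and the Doob integral. -/

section Expansion

variable {ℙ : Measure Ω} {S : ℝ → ℝ}

/-- The random measure `A ↦ V 1_A` of an isometry `V : L²(S dy) → L²(Ω)`. -/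
def isometryMeasure [IsFiniteMeasure (spectralMeasure S)]
    (V : Lp ℂ 2 (spectralMeasure S) →ₗᵢ[ℂ] Lp ℂ 2 ℙ) (A : Set ℝ) : Ω → ℂ := by
  classical
  exact if hA : MeasurableSet A then
    V (indicatorConstLp 2 hA (measure_ne_top (spectralMeasure S) A) (1 : ℂ)) else 0

lemma isometryMeasure_apply [IsFiniteMeasure (spectralMeasure S)]
    (V : Lp ℂ 2 (spectralMeasure S) →ₗᵢ[ℂ] Lp ℂ 2 ℙ) {A : Set ℝ} (hA : MeasurableSet A) :
    isometryMeasure V A =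
      V (indicatorConstLp 2 hA (measure_ne_top (spectralMeasure S) A) (1 : ℂ)) := by
  rw [isometryMeasure, dif_pos hA]

lemma isOrthogonalMeasure_isometryMeasure [IsFiniteMeasure (spectralMeasure S)]
    (hS : Integrable S unitBand) (h0 : ∀ᵐ y ∂unitBand, 0 ≤ S y)
    (V : Lp ℂ 2 (spectralMeasure S) →ₗᵢ[ℂ] Lp ℂ 2 ℙ) :
    IsOrthogonalMeasure ℙ S (isometryMeasure V) where
  memLp A hA _ := by
    rw [isometryMeasure_apply V hA]; exact Lp.memLp _
  orthogonal A B hA hB hAs _ := by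
    rw [isometryMeasure_apply V hA, isometryMeasure_apply V hB]
    -- `B` comes first because the inner product conjugates its left argument.
    have h1 := V.inner_map_map
      (indicatorConstLp 2 hB (measure_ne_top (spectralMeasure S) B) (1 : ℂ))
      (indicatorConstLp 2 hA (measure_ne_top (spectralMeasure S) A) (1 : ℂ))
    rw [L2.inner_def, L2.inner_indicatorConstLp_one] at h1
    simp only [RCLike.inner_apply] at h1
    rw [h1, integral_congr_ae (ae_restrict_of_ae indicatorConstLp_coeFn),
      setIntegral_indicator hA, setIntegral_const, inter_comm,
      spectralMeasure_real_eq hS h0 (hA.inter hB) (inter_subset_left.trans hAs)]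
    simp

/-- Linearity of `V` on finite sums of indicators. Cutting the fibres down to `[0, 1)` changes
nothing, as the spectral measure lives there. -/
lemma simpleIntegral_isometryMeasure [IsFiniteMeasure (spectralMeasure S)]
    (V : Lp ℂ 2 (spectralMeasure S) →ₗᵢ[ℂ] Lp ℂ 2 ℙ) (g : SimpleFunc ℝ ℂ)
    (hg : MemLp g 2 (spectralMeasure S)) :
    simpleIntegral (isometryMeasure V) g =ᵐ[ℙ] V (hg.toLp g) := by
  have hm : ∀ c : ℂ, MeasurableSet (g ⁻¹' {c} ∩ Ico 0 1) := fun c =>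
    (g.measurableSet_fiber c).inter measurableSet_Ico
  have h1 : hg.toLp g = ∑ c ∈ g.range, c • indicatorConstLp 2 (hm c)
      (measure_ne_top (spectralMeasure S) _) (1 : ℂ) := by
    refine Lp.ext ?_
    filter_upwards [hg.coeFn_toLp, Lp.coeFn_finsetSum g.range fun c => c • indicatorConstLp 2 (hm c)
      (measure_ne_top (spectralMeasure S) _) (1 : ℂ), ae_mem_Ico_spectralMeasure,
      (ae_ball_iff g.range.countable_toSet).2 fun c _ => Lp.coeFn_smul c (indicatorConstLp 2 (hm c)
        (measure_ne_top (spectralMeasure S) _) (1 : ℂ)),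
      (ae_ball_iff g.range.countable_toSet).2 fun c _ => indicatorConstLp_coeFn (p := 2)
        (hs := hm c) (hμs := measure_ne_top (spectralMeasure S) _) (c := (1 : ℂ))]
      with y h2 h3 h4 h5 h6
    rw [h2, h3, Finset.sum_apply, Finset.sum_eq_single (g y)]
    · rw [h5 _ (SimpleFunc.mem_range_self g y), Pi.smul_apply,
        h6 _ (SimpleFunc.mem_range_self g y), indicator_of_mem (show y ∈ g ⁻¹' {g y} ∩ Ico 0 1 from ⟨rfl, h4⟩)]
      simp
    · intro c hc hne
      rw [h5 c hc, Pi.smul_apply, h6 c hc, indicator_of_notMem fun h => hne h.1.symm, smul_zero]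
    · exact fun h => absurd (SimpleFunc.mem_range_self g y) h
  rw [h1, map_sum]
  filter_upwards [Lp.coeFn_finsetSum g.range fun c => V (c • indicatorConstLp 2 (hm c)
      (measure_ne_top (spectralMeasure S) _) (1 : ℂ)),
    (ae_ball_iff g.range.countable_toSet).2 fun c _ => Lp.coeFn_smul c (V (indicatorConstLp 2 (hm c)
        (measure_ne_top (spectralMeasure S) _) (1 : ℂ)))] with ω h2 h3
  rw [h2, simpleIntegral, Finset.sum_apply]
  refine Finset.sum_congr rfl fun c hc => ?_
  rw [isometryMeasure_apply V (hm c), map_smul, h3 c hc, Pi.smul_apply, smul_eq_mul]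

/-- Simple functions approximate `f` in `L²(S)`, and `V` carries each error to one of the same norm
in `L²(Ω)`. -/
lemma isDoobIntegral_isometryMeasure [IsFiniteMeasure (spectralMeasure S)]
    (V : Lp ℂ 2 (spectralMeasure S) →ₗᵢ[ℂ] Lp ℂ 2 ℙ) {f : ℝ → ℂ}
    (hf : MemLp f 2 (spectralMeasure S)) {Y : Ω → ℂ} (hY : MemLp Y 2 ℙ)
    (h : V (hf.toLp f) = hY.toLp Y) : IsDoobIntegral ℙ S (isometryMeasure V) f Y := by
  have hex : ∀ j : ℕ, ∃ g : SimpleFunc ℝ ℂ, eLpNorm (f - ⇑g) 2 (spectralMeasure S) <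
      ((j : ENNReal) + 1)⁻¹ ∧ MemLp (⇑g) 2 (spectralMeasure S) := fun j =>
    hf.exists_simpleFunc_eLpNorm_sub_lt (by simp) (by simp)
  choose g hg hgm using hex
  have hlim : Tendsto (fun j => eLpNorm (fun y => f y - g j y) 2 (spectralMeasure S)) atTop
      (𝓝 0) := by
    refine tendsto_of_tendsto_of_tendsto_of_le_of_le tendsto_const_nhds
      (h := fun j : ℕ => ((j : ENNReal) + 1)⁻¹) ?_ (fun _ => zero_le) fun j => (hg j).le
    have := (tendsto_add_atTop_iff_nat 1).2 ENNReal.tendsto_inv_nat_nhds_zero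
    simpa using this
  refine ⟨g, hlim, hlim.congr fun j => ?_⟩
  have h1 : ‖V (hf.toLp f - (hgm j).toLp (g j))‖ₑ = ‖hf.toLp f - (hgm j).toLp (g j)‖ₑ := by
    rw [enorm_eq_iff_norm_eq, V.norm_map]
  rw [map_sub, h, ← MemLp.toLp_sub, Lp.enorm_toLp, Lp.enorm_def] at h1
  refine h1.symm.trans (eLpNorm_congr_ae ?_)
  filter_upwards [Lp.coeFn_sub (hY.toLp Y) (V ((hgm j).toLp (g j))), hY.coeFn_toLp,
    simpleIntegral_isometryMeasure V (g j) (hgm j)] with ω h2 h3 h4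
  rw [h2, Pi.sub_apply, h3, h4]

/-- The spectral representation of a process whose autocorrelation is `∫ S φ(n) φ*(m)`. -/
theorem exists_orthogonalMeasure {x : ℤ → Ω → ℂ} {φ : ℤ → ℝ → ℂ} (hx : ∀ n, MemLp (x n) 2 ℙ)
    (hφ : ∀ n, AEStronglyMeasurable (φ n) unitBand) {K : ℝ}
    (hK : ∀ n, ∀ᵐ y ∂unitBand, ‖φ n y‖ ≤ K)
    (hS : Integrable S unitBand) (h0 : ∀ᵐ y ∂unitBand, 0 ≤ S y) {M : ℝ}
    (hM : ∀ᵐ y ∂unitBand, ‖S y‖ ≤ M)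
    (hmom : ∀ n m, ∫ y, (S y : ℂ) * (φ n y * conj (φ m y)) ∂unitBand = autocorr ℙ x m (n - m))
    (htot : ∀ f : ℝ → ℂ, MemLp f 2 unitBand → (∀ n, ∫ y, conj (φ n y) * f y ∂unitBand = 0) →
      ∀ᵐ y ∂unitBand, f y = 0) :
    ∃ ξ : Set ℝ → Ω → ℂ, IsOrthogonalMeasure ℙ S ξ ∧ ∀ n, IsDoobIntegral ℙ S ξ (φ n) (x n) := by
  have := isFiniteMeasure_spectralMeasure hS
  have hac := spectralMeasure_absolutelyContinuous (S := S)
  have hmem : ∀ n, MemLp (φ n) 2 (spectralMeasure S) := fun n =>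
    MemLp.of_bound ((hφ n).mono_ac hac) K (hac.ae_le (hK n))
  have hinner : ∀ n {g : ℝ → ℂ} (hg : MemLp g 2 (spectralMeasure S)),
      inner ℂ ((hmem n).toLp (φ n)) (hg.toLp g) = ∫ y, conj (φ n y) * g y ∂spectralMeasure S := by
    intro n g hg
    rw [L2.inner_def]
    refine integral_congr_ae ?_
    filter_upwards [(hmem n).coeFn_toLp, hg.coeFn_toLp] with y h1 h2
    rw [h1, h2, RCLike.inner_apply, mul_comm]
  obtain ⟨V, hV⟩ := exists_linearIsometry_of_inner_eq (v := fun n => (hmem n).toLp (φ n))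
    (w := fun n => (hx n).toLp (x n)) (by
      intro m n
      rw [hinner, inner_toLp_eq_autocorr, ← hmom, integral_spectralMeasure hS h0]
      congr 1; ext y; ring) (by
      rw [Submodule.eq_bot_iff]
      intro F hF
      refine Lp.eq_zero_iff_ae_eq_zero.2 (ae_eq_zero_spectralMeasure hS h0 hM htot
        (Lp.stronglyMeasurable F) (Lp.memLp F) fun n => ?_)
      rw [← hinner n (Lp.memLp F), Lp.toLp_coeFn]
      exact (Submodule.mem_orthogonal _ _).1 hF _ (Submodule.subset_span ⟨n, rfl⟩))
  exact ⟨isometryMeasure V, isOrthogonalMeasure_isometryMeasure hS h0 V, fun n =>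
    isDoobIntegral_isometryMeasure V (hmem n) (hx n) (hV n)⟩

end Expansion

/-! ### Eigenvalue estimates. -/

/-- The Rayleigh quotient of a unit eigenvector; it is the source of the sign, the bound and the
measurability of the spectrum. -/
lemma eigenvalue_eq_quadratic {P : ℕ} {A : Matrix (Fin P) (Fin P) ℂ} {v : Fin P → Fin P → ℂ}
    {μ : Fin P → ℝ} (h : IsOrthonormalEigenbasis A v μ) (p : Fin P) :
    (μ p : ℂ) = star (v p) ⬝ᵥ (A *ᵥ v p) := by
  have h1 := (orthonormal_toLp_iff v).1 h.1 p p
  rw [if_pos rfl] at h1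
  rw [h.2 p, dotProduct_smul, dotProduct_comm]
  simp [dotProduct, h1]

lemma eigenvalue_nonneg {P : ℕ} {A : Matrix (Fin P) (Fin P) ℂ} {v : Fin P → Fin P → ℂ}
    {μ : Fin P → ℝ} (h : IsOrthonormalEigenbasis A v μ) (hA : A.PosSemidef) (p : Fin P) :
    0 ≤ μ p := by
  have h1 := hA.dotProduct_mulVec_nonneg (v p)
  rw [← eigenvalue_eq_quadratic h p] at h1
  exact_mod_cast h1

lemma norm_eigenvalue_le {P : ℕ} {A : Matrix (Fin P) (Fin P) ℂ} {v : Fin P → Fin P → ℂ}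
    {μ : Fin P → ℝ} (h : IsOrthonormalEigenbasis A v μ) {C : ℝ} (hC : ∀ r c, ‖A r c‖ ≤ C)
    (p : Fin P) : ‖μ p‖ ≤ P * (P * C) := by
  have hv := norm_le_one_of_orthonormal h.1
  have hC0 : 0 ≤ C := (norm_nonneg _).trans (hC p p)
  rw [← Complex.norm_real, eigenvalue_eq_quadratic h p]
  have h1 : ∀ r, ‖(A *ᵥ v p) r‖ ≤ P * C := fun r => by
    have h2 : ‖∑ c, A r c * v p c‖ ≤ ∑ _c : Fin P, C := by
      refine norm_sum_le_of_le _ fun c _ => ?_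
      rw [norm_mul]
      exact (mul_le_mul (hC r c) (hv p c) (norm_nonneg _) hC0).trans_eq (mul_one C)
    exact h2.trans_eq (by simp)
  have h2 : ‖∑ r, star (v p) r * (A *ᵥ v p) r‖ ≤ ∑ _r : Fin P, P * C := by
    refine norm_sum_le_of_le _ fun r _ => ?_
    rw [norm_mul]
    have h2 : ‖star (v p) r‖ ≤ 1 := by simpa using hv p r
    exact (mul_le_mul h2 (h1 r) (norm_nonneg _) zero_le_one).trans_eq (one_mul _)
  exact h2.trans_eq (by simp)

/-! ### Characterisation of the KL eigenbases. -/

section Converse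

variable {ℙ : Measure Ω} {x : ℤ → Ω → ℂ} {P : ℕ} {φ : ℤ → ℝ → ℂ} {b : Fin P → ℝ → Fin P → ℂ}
  {S : ℝ → ℝ}

lemma HasCSForm.aestronglyMeasurable (hP : 0 < P) (h : HasCSForm P φ b)
    (hb : ∀ p, AEMeasurable (b p) (subBand P)) (n : ℤ) : AEStronglyMeasurable (φ n) unitBand := by
  rw [aestronglyMeasurable_unitBand_iff hP]
  intro p
  refine AEStronglyMeasurable.congr ?_ (h.ae_eq p n).symm
  refine Finset.aestronglyMeasurable_fun_sum _ fun q _ => ?_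
  exact ((measurable_pi_apply q).comp_aemeasurable (hb p)).aestronglyMeasurable.mul
    ((continuous_expo n).comp (by fun_prop)).aestronglyMeasurable

lemma HasCSForm.ae_norm_le (hP : 0 < P) (h : HasCSForm P φ b)
    (horth : ∀ᵐ σ ∂subBand P,
      Orthonormal ℂ (fun p => (WithLp.toLp 2 (b p σ) : EuclideanSpace ℂ (Fin P)))) (n : ℤ) :
    ∀ᵐ y ∂unitBand, ‖φ n y‖ ≤ P := by
  rw [ae_unitBand_iff hP]
  filter_upwards [horth, ae_restrict_mem measurableSet_Ico] with σ hσ hm p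
  rw [h p σ hm n]
  refine (norm_csFun_le _ _ _).trans ((Finset.sum_le_sum fun q _ =>
    norm_le_one_of_orthonormal hσ p q).trans_eq (by simp))

/-- Multiply the eigenequation at `n` by `conj (φ m)` and integrate term by term: orthonormality
keeps only `l = m`. The exchange is justified by the summable bound `ρ (n - l) * K²`, up to the
total mass. -/
lemma integral_spectrum_mul_eq_autocorr (hx : IsCyclostationary ℙ x P)
    (hsum : ∀ n : ℤ, Summable fun m : ℤ => ‖autocorr ℙ x n m‖)
    (hφ : ∀ n, AEStronglyMeasurable (φ n) unitBand) {K : ℝ}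
    (hK : ∀ n, ∀ᵐ y ∂unitBand, ‖φ n y‖ ≤ K)
    (horth : ∀ n n' : ℤ, ∫ y, φ n y * conj (φ n' y) ∂unitBand = if n = n' then 1 else 0)
    (heig : ∀ᵐ y ∂unitBand, Eigenequation ℙ x (fun n => φ n y) (S y)) (n m : ℤ) :
    ∫ y, (S y : ℂ) * (φ n y * conj (φ m y)) ∂unitBand = autocorr ℙ x m (n - m) := by
  obtain ⟨ρ, hρ, hle⟩ := hx.exists_summable_bound hsum
  set F : ℤ → ℝ → ℂ := fun l y => autocorr ℙ x l (n - l) * (φ l y * conj (φ m y)) with hF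
  have hmem : ∀ n, MemLp (φ n) 2 unitBand := fun n => MemLp.of_bound (hφ n) K (hK n)
  have hFi : ∀ l, Integrable (F l) unitBand := fun l =>
    ((hmem l).integrable_mul (hmem m).star).const_mul _
  have hFn : ∀ l, ∫ y, ‖F l y‖ ∂unitBand ≤ ρ (n - l) * (∫ _, K * K ∂unitBand) := by
    intro l
    rw [← integral_const_mul]
    refine integral_mono_ae (hFi l).norm (integrable_const _) ?_
    filter_upwards [hK l, hK m] with y h1 h2
    have hK0 : 0 ≤ K := (norm_nonneg _).trans h1
    simp only [hF, norm_mul, RCLike.norm_conj]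
    exact mul_le_mul (hle _ _) (mul_le_mul h1 h2 (norm_nonneg _) hK0) (by positivity)
      ((norm_nonneg _).trans (hle 0 _))
  have hs : Summable fun l => ∫ y, ‖F l y‖ ∂unitBand := by
    refine Summable.of_nonneg_of_le (fun l => integral_nonneg fun y => norm_nonneg _) hFn ?_
    exact ((Equiv.subLeft n).summable_iff.2 hρ).mul_right _
  have h1 := hasSum_integral_of_summable_integral_norm hFi hs
  have h2 : ∀ l, ∫ y, F l y ∂unitBand = autocorr ℙ x l (n - l) * if l = m then 1 else 0 := by
    intro l
    rw [← horth l m, ← integral_const_mul]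
  have h3 : ∫ y, ∑' l, F l y ∂unitBand = ∫ y, (S y : ℂ) * (φ n y * conj (φ m y)) ∂unitBand := by
    refine integral_congr_ae ?_
    filter_upwards [heig] with y hy
    have := (hy n).mul_right (conj (φ m y))
    simp only [mul_assoc] at this
    exact this.tsum_eq
  rw [← h3, ← h1.tsum_eq]
  simp_rw [h2]
  rw [tsum_eq_single m fun l hl => by rw [if_neg hl, mul_zero], if_pos rfl, mul_one]

lemma HasCSForm.eigenequation_iff (hx : IsCyclostationary ℙ x P)
    (hsum : ∀ n : ℤ, Summable fun m : ℤ => ‖autocorr ℙ x n m‖) (h : HasCSForm P φ b) :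
    (∀ᵐ y ∂unitBand, Eigenequation ℙ x (fun n => φ n y) (S y)) ↔
      ∀ᵐ σ ∂subBand P, ∀ p : Fin P, cyclicPSD ℙ x P σ *ᵥ b p σ =
        (S (σ + ((p : ℕ) : ℝ) / (P : ℝ)) : ℂ) • b p σ := by
  rw [ae_unitBand_iff hx.period_pos]
  refine eventually_congr ?_
  filter_upwards [ae_restrict_mem measurableSet_Ico] with σ hσ
  refine forall_congr' fun p => ?_
  rw [← eigenequation_csFun_iff hx hsum, funext (h p σ hσ)]

theorem HasCSForm.isKLEigenbasis_iff (hx : IsCyclostationary ℙ x P)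
    (hsum : ∀ n : ℤ, Summable fun m : ℤ => ‖autocorr ℙ x n m‖)
    (hb : ∀ p, AEMeasurable (b p) (subBand P)) (h : HasCSForm P φ b) :
    IsKLEigenbasis ℙ x φ S ↔ ∀ᵐ σ ∂subBand P,
      IsOrthonormalEigenbasis (cyclicPSD ℙ x P σ) (fun p => b p σ)
        (fun p => S (σ + ((p : ℕ) : ℝ) / (P : ℝ))) := by
  have hP := hx.period_pos
  constructor
  · intro hKL
    filter_upwards [h.orthonormal_coeff hP hKL.memLp hKL.orthonormal,
      (h.eigenequation_iff hx hsum).1 hKL.eigen] with σ h1 h2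
    exact ⟨h1, h2⟩
  · intro hE
    have ho := hE.mono fun σ hσ => hσ.1
    have heig := (h.eigenequation_iff hx hsum).2 (hE.mono fun σ hσ => hσ.2)
    have hφ := h.aestronglyMeasurable hP hb
    have hK := h.ae_norm_le hP ho
    have hmem : ∀ n, MemLp (φ n) 2 unitBand := fun n => MemLp.of_bound (hφ n) P (hK n)
    have horth : ∀ n n' : ℤ, ∫ y, φ n y * conj (φ n' y) ∂unitBand = if n = n' then 1 else 0 := by
      intro n n'
      have hI : Integrable (fun y => φ n y * conj (φ n' y)) unitBand :=
        (hmem n).integrable_mul (hmem n').star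
      rw [← integral_sum_expo_mul_conj hP n n', integral_unitBand hP hI]
      refine integral_congr_ae ?_
      filter_upwards [ho, ae_restrict_mem measurableSet_Ico] with σ h1 hσ
      rw [← sum_csFun_mul_conj h1]
      exact Finset.sum_congr rfl fun p _ => by rw [h p σ hσ n, h p σ hσ n']
    have htot := fun f hf => h.ae_eq_zero_of_integral_eq_zero hP hb ho hmem (f := f) hf
    have h0 : ∀ᵐ y ∂unitBand, 0 ≤ S y := by
      rw [ae_unitBand_iff hP]
      filter_upwards [hE] with σ hσ p
      exact eigenvalue_nonneg hσ (posSemidef_cyclicPSD hx hsum σ) p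
    obtain ⟨C, hC⟩ := norm_cyclicPSD_apply_le hx hsum
    have hM : ∀ᵐ y ∂unitBand, ‖S y‖ ≤ P * (P * C) := by
      rw [ae_unitBand_iff hP]
      filter_upwards [hE] with σ hσ p
      exact norm_eigenvalue_le hσ (hC σ) p
    -- Measurability of `S` is not assumed; it is recovered from the Rayleigh quotients of the
    -- measurable coefficient vectors.
    have hSm : AEStronglyMeasurable S unitBand := by
      rw [aestronglyMeasurable_unitBand_iff hP]
      intro p
      have hbq : ∀ q, AEStronglyMeasurable (fun σ => b p σ q) (subBand P) := fun q =>
        ((measurable_pi_apply q).comp_aemeasurable (hb p)).aestronglyMeasurable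
      have h1 : AEStronglyMeasurable (fun σ => ∑ r, star (b p σ r) *
          ∑ c, cyclicPSD ℙ x P σ r c * b p σ c) (subBand P) :=
        Finset.aestronglyMeasurable_fun_sum _ fun r _ => (hbq r).star.mul
          (Finset.aestronglyMeasurable_fun_sum _ fun c _ =>
            (continuous_cyclicPSD hx hsum r c).aestronglyMeasurable.mul (hbq c))
      refine (Complex.continuous_re.comp_aestronglyMeasurable h1).congr ?_
      filter_upwards [hE] with σ hσ
      have h2 := congrArg Complex.re (eigenvalue_eq_quadratic hσ p)
      exact h2.symm
    have hS : Integrable S unitBand := Integrable.of_bound hSm _ hM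
    exact
      { memLp := hmem
        orthonormal := horth
        complete := fun f hf => tendsto_eLpNorm_partial_sum hmem horth htot hf
        eigen := heig
        spectrum_nonneg := h0
        spectrum_integrable := hS
        expansion := exists_orthogonalMeasure hx.second_order hφ hK hS h0 hM
          (integral_spectrum_mul_eq_autocorr hx hsum hφ hK horth heig) htot }

end Converse

/-! ### Measurable selection of eigenvectors. -/

section Selection

/-- On a compact set `|g x|` attains its minimum, so a zero exists exactly when the values on a
countable dense subset become arbitrarily small. -/
lemma measurableSet_exists_zero {X Y : Type*} [MeasurableSpace X] [TopologicalSpace Y]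
    [TopologicalSpace.PseudoMetrizableSpace Y] {g : X → Y → ℝ} (hgm : ∀ y, Measurable fun x => g x y)
    (hgc : ∀ x, Continuous (g x)) {K : Set Y} (hK : IsCompact K) :
    MeasurableSet {x | ∃ y ∈ K, g x y = 0} := by
  obtain ⟨D, hDK, hDc, hKD⟩ := hK.isSeparable.exists_countable_dense_subset
  have h : {x | ∃ y ∈ K, g x y = 0} = ⋂ n : ℕ, ⋃ y ∈ D, {x | |g x y| < 1 / ((n : ℝ) + 1)} := by
    ext z
    simp only [mem_ofPred_eq, mem_iInter, mem_iUnion, exists_prop]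
    constructor
    · rintro ⟨y, hy, h0⟩ n
      have hopen : IsOpen {y | |g z y| < 1 / ((n : ℝ) + 1)} :=
        isOpen_lt (hgc z).abs continuous_const
      have hy' : y ∈ {y | |g z y| < 1 / ((n : ℝ) + 1)} := by
        simp only [mem_ofPred_eq, h0, abs_zero]; positivity
      obtain ⟨d, hd, hdD⟩ := mem_closure_iff.1 (hKD hy) _ hopen hy'
      exact ⟨d, hdD, hd⟩
    · intro hn
      obtain ⟨d, hd, -⟩ := hn 0
      obtain ⟨y, hy, hmin⟩ := hK.exists_isMinOn ⟨d, hDK hd⟩ (hgc z).abs.continuousOn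
      refine ⟨y, hy, by_contra fun hne => ?_⟩
      obtain ⟨n, hlt⟩ := exists_nat_one_div_lt (abs_pos.2 hne)
      obtain ⟨d', hd', hd''⟩ := hn n
      exact absurd (hmin (hDK hd')) (not_le.2 (hd''.trans hlt))
  rw [h]
  refine MeasurableSet.iInter fun n => MeasurableSet.biUnion hDc fun y _ => ?_
  exact measurableSet_lt (hgm y).abs measurable_const

/-- Measurable selection of a zero of a Carathéodory function on a compact metric space. -/
theorem exists_measurable_zero {X Y : Type*} [MeasurableSpace X] [MetricSpace Y] [CompactSpace Y]
    [MeasurableSpace Y] [BorelSpace Y] {g : X → Y → ℝ} (hgm : ∀ y, Measurable fun x => g x y)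
    (hgc : ∀ x, Continuous (g x)) (hg : ∀ x, ∃ y, g x y = 0) :
    ∃ s : X → Y, Measurable s ∧ ∀ x, g x (s x) = 0 := by
  rcases isEmpty_or_nonempty X with hX | ⟨⟨x₀⟩⟩
  · exact ⟨fun x => (hX.false x).elim, measurable_of_empty _, fun x => (hX.false x).elim⟩
  have : Nonempty Y := ⟨(hg x₀).choose⟩
  -- The Cantor set maps onto `Y`, so the zeros pull back to a nonempty compact set of reals, whose
  -- least element is a canonical choice.
  obtain ⟨f₀, hf₀, hf₀s⟩ := exists_nat_bool_continuous_surjective_of_compact Y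
  set f : cantorSet → Y := f₀ ∘ cantorSetHomeomorphNatToBool with hf
  have hfc : Continuous f := hf₀.comp cantorSetHomeomorphNatToBool.continuous
  have hfs : Function.Surjective f := hf₀s.comp cantorSetHomeomorphNatToBool.surjective
  set Z : X → Set ℝ := fun x => (↑) '' {u : cantorSet | g x (f u) = 0} with hZ
  have hcs : CompactSpace cantorSet := isCompact_iff_compactSpace.1 isCompact_cantorSet
  have hZc : ∀ x, IsCompact (Z x) := fun x =>
    (isClosed_singleton.preimage ((hgc x).comp hfc)).isCompact.image continuous_subtype_val
  have hZne : ∀ x, (Z x).Nonempty := fun x => by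
    obtain ⟨y, hy⟩ := hg x
    obtain ⟨u, rfl⟩ := hfs y
    exact ⟨u, u, hy, rfl⟩
  have hmem : ∀ x, sInf (Z x) ∈ Z x := fun x => (hZc x).sInf_mem (hZne x)
  have hm : Measurable fun x => sInf (Z x) := by
    refine measurable_of_Iic fun t => ?_
    -- The least zero is at most `t` exactly when some zero lies in the compact part of the Cantor
    -- set below `t`.
    have h1 := measurableSet_exists_zero (g := fun x (u : cantorSet) => g x (f u))
      (fun u => hgm (f u)) (fun x => (hgc x).comp hfc) (K := {u : cantorSet | (u : ℝ) ≤ t})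
      (isClosed_le continuous_subtype_val continuous_const).isCompact
    convert h1 using 1
    ext x
    simp only [mem_preimage, mem_Iic, mem_ofPred_eq]
    constructor
    · intro h
      obtain ⟨u, hu, hu'⟩ := hmem x
      exact ⟨u, hu' ▸ h, hu⟩
    · rintro ⟨u, hu, hu'⟩
      exact (csInf_le (hZc x).bddBelow ⟨u, hu', rfl⟩).trans hu
  have hsub : ∀ x, sInf (Z x) ∈ cantorSet := fun x => by
    obtain ⟨u, -, hu⟩ := hmem x
    rw [← hu]; exact u.2
  refine ⟨fun x => f ⟨sInf (Z x), hsub x⟩, hfc.measurable.comp (hm.subtype_mk), fun x => ?_⟩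
  obtain ⟨u, hu, hu'⟩ := hmem x
  have h1 : (⟨sInf (Z x), hsub x⟩ : cantorSet) = u := Subtype.ext hu'.symm
  exact (congrArg (fun u => g x (f u)) h1).trans hu

/-- A measurable family of Hermitian matrices has measurable orthonormal eigenvectors. -/
theorem exists_measurable_eigenbasis {P : ℕ} {X : Type*} [MeasurableSpace X]
    {A : X → Matrix (Fin P) (Fin P) ℂ} (hA : ∀ r c, Measurable fun x => A x r c)
    (hH : ∀ x, (A x).IsHermitian) :
    ∃ (v : Fin P → X → Fin P → ℂ) (μ : X → Fin P → ℝ), (∀ p, Measurable (v p)) ∧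
      ∀ x, IsOrthonormalEigenbasis (A x) (fun p => v p x) (μ x) := by
  set Y : Set (Fin P → Fin P → ℂ) :=
    {v | ∀ p p', ∑ q, v p q * conj (v p' q) = if p = p' then 1 else 0} with hY
  have hYo : ∀ v ∈ Y, Orthonormal ℂ
      (fun p => (WithLp.toLp 2 (v p) : EuclideanSpace ℂ (Fin P))) := fun v hv =>
    (orthonormal_toLp_iff v).2 hv
  have hYc : IsCompact Y := by
    refine Metric.isCompact_of_isClosed_isBounded ?_ ?_
    · simp only [hY, ofPred_forall]
      refine isClosed_iInter fun p => isClosed_iInter fun p' => isClosed_eq ?_ continuous_const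
      exact continuous_finsetSum _ fun q _ => (by fun_prop : Continuous
        fun v : Fin P → Fin P → ℂ => v p q).mul (Complex.continuous_conj.comp (by fun_prop))
    · refine (Metric.isBounded_closedBall (x := 0) (r := 1)).subset fun v hv => ?_
      rw [mem_closedBall_zero_iff, pi_norm_le_iff_of_nonneg zero_le_one]
      intro p
      rw [pi_norm_le_iff_of_nonneg zero_le_one]
      exact norm_le_one_of_orthonormal (hYo v hv) p
  have : CompactSpace Y := isCompact_iff_compactSpace.1 hYc
  -- Inserting the Rayleigh quotient eliminates the unknown eigenvalue, so the selection runs over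
  -- the compact set of orthonormal frames alone.
  set g : X → Y → ℝ := fun x v => ∑ p, ∑ r, ‖(A x *ᵥ v.1 p) r -
    ((star (v.1 p) ⬝ᵥ (A x *ᵥ v.1 p)).re : ℂ) * v.1 p r‖ with hg
  have hgm : ∀ v, Measurable fun x => g x v := by
    intro v
    simp only [hg, Matrix.mulVec, dotProduct]
    fun_prop
  have hgc : ∀ x, Continuous (g x) := by
    intro x
    have hv : ∀ p q, Continuous fun v : Y => v.1 p q := fun p q =>
      (continuous_apply_apply p q).comp continuous_subtype_val
    have hAv : ∀ p r, Continuous fun v : Y => ∑ c, A x r c * v.1 p c := fun p r =>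
      continuous_finsetSum _ fun c _ => continuous_const.mul (hv p c)
    refine continuous_finsetSum _ fun p _ => continuous_finsetSum _ fun r _ =>
      ((hAv p r).sub (Continuous.mul ?_ (hv p r))).norm
    refine Complex.continuous_ofReal.comp (Complex.continuous_re.comp ?_)
    exact continuous_finsetSum _ fun q _ => (hv p q).star.mul (hAv p q)
  have hg0 : ∀ x (v : Y), g x v = 0 → IsOrthonormalEigenbasis (A x) v.1
      fun p => (star (v.1 p) ⬝ᵥ (A x *ᵥ v.1 p)).re := by
    intro x v h
    refine ⟨hYo v.1 v.2, fun p => funext fun r => ?_⟩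
    rw [hg, Finset.sum_eq_zero_iff_of_nonneg fun p _ => Finset.sum_nonneg fun r _ =>
      norm_nonneg _] at h
    have h1 := (Finset.sum_eq_zero_iff_of_nonneg fun r _ => norm_nonneg _).1
      (h p (Finset.mem_univ p)) r (Finset.mem_univ r)
    exact sub_eq_zero.1 (norm_eq_zero.1 h1)
  have hex : ∀ x, ∃ v, g x v = 0 := by
    intro x
    set B := (hH x).eigenvectorBasis
    have hB : IsOrthonormalEigenbasis (A x) (fun p => (B p).ofLp) (hH x).eigenvalues := by
      refine ⟨B.orthonormal, fun p => ?_⟩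
      simpa using (hH x).mulVec_eigenvectorBasis p
    refine ⟨⟨fun p => (B p).ofLp, (orthonormal_toLp_iff _).1 hB.1⟩, ?_⟩
    refine Finset.sum_eq_zero fun p _ => Finset.sum_eq_zero fun r _ => ?_
    rw [← eigenvalue_eq_quadratic hB p, Complex.ofReal_re, hB.2 p]
    simp
  obtain ⟨s, hs, hs0⟩ := exists_measurable_zero hgm hgc hex
  exact ⟨fun p x => (s x).1 p, _, fun p => (measurable_pi_apply p).comp
    (measurable_subtype_coe.comp hs), fun x => hg0 x (s x) (hs0 x)⟩

end Selection

/-! ### Gluing the sub-bands into a KL eigenbasis. -/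

/-- Index of the subband `[p/P, (p+1)/P)` that contains a point. -/
def bandIndex {P : ℕ} (hP : 0 < P) (y : ℝ) : Fin P :=
  -- The remainder only supplies a default index outside `[0, 1)`; inside, the floor is already
  -- below `P`.
  ⟨⌊y * P⌋₊ % P, Nat.mod_lt _ hP⟩

lemma bandIndex_add {P : ℕ} (hP : 0 < P) (p : Fin P) {σ : ℝ}
    (hσ : σ ∈ Ico (0 : ℝ) (1 / (P : ℝ))) :
    bandIndex hP (σ + ((p : ℕ) : ℝ) / (P : ℝ)) = p := by
  have hPr : (0 : ℝ) < P := by exact_mod_cast hP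
  have h1 : ⌊(σ + ((p : ℕ) : ℝ) / (P : ℝ)) * P⌋₊ = p := by
    have h2 : (σ + ((p : ℕ) : ℝ) / (P : ℝ)) * P = σ * P + (p : ℕ) := by field_simp
    have h3 : σ * P < 1 := (lt_div_iff₀ hPr).1 hσ.2
    have h4 : 0 ≤ σ * P := mul_nonneg hσ.1 hPr.le
    rw [h2, Nat.floor_add_natCast h4, Nat.floor_eq_zero.2 h3, zero_add]
  ext
  simp only [bandIndex, h1]
  exact Nat.mod_eq_of_lt p.2

theorem exists_isKLEigenbasis {ℙ : Measure Ω} {x : ℤ → Ω → ℂ} {P : ℕ}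
    (hx : IsCyclostationary ℙ x P)
    (hsum : ∀ n : ℤ, Summable fun m : ℤ => ‖autocorr ℙ x n m‖) :
    ∃ (b : Fin P → ℝ → Fin P → ℂ) (φ : ℤ → ℝ → ℂ) (S : ℝ → ℝ),
      (∀ p, Measurable (b p)) ∧ HasCSForm P φ b ∧
      (∀ σ ∈ Ico (0 : ℝ) (1 / (P : ℝ)),
        IsOrthonormalEigenbasis (cyclicPSD ℙ x P σ) (fun p => b p σ)
          (fun p => S (σ + ((p : ℕ) : ℝ) / (P : ℝ)))) ∧
      IsKLEigenbasis ℙ x φ S := by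
  have hP := hx.period_pos
  obtain ⟨b, μ, hb, hE⟩ := exists_measurable_eigenbasis
    (fun r c => (continuous_cyclicPSD hx hsum r c).measurable)
    (fun σ => (posSemidef_cyclicPSD hx hsum σ).isHermitian)
  set ι := bandIndex hP
  -- `τ` folds a point of `[0, 1)` back to `[0, 1/P)`, so that `φ` and `S` can be defined on the
  -- whole line from the selected eigenvectors and eigenvalues.
  set τ : ℝ → ℝ := fun y => y - ((ι y : ℕ) : ℝ) / (P : ℝ) with hτ
  set φ : ℤ → ℝ → ℂ := fun n y => csFun (b (ι y) (τ y)) (τ y) n with hφ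
  set S : ℝ → ℝ := fun y => μ (τ y) (ι y) with hS
  have hι : ∀ (p : Fin P), ∀ σ ∈ Ico (0 : ℝ) (1 / (P : ℝ)),
      ι (σ + ((p : ℕ) : ℝ) / (P : ℝ)) = p ∧ τ (σ + ((p : ℕ) : ℝ) / (P : ℝ)) = σ := by
    intro p σ hσ
    have h1 : ι (σ + ((p : ℕ) : ℝ) / (P : ℝ)) = p := bandIndex_add hP p hσ
    exact ⟨h1, by simp only [hτ, h1, add_sub_cancel_right]⟩
  have hcs : HasCSForm P φ b := by
    intro p σ hσ n
    obtain ⟨h1, h2⟩ := hι p σ hσ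
    simp only [hφ, h1, h2]
  have hES : ∀ σ ∈ Ico (0 : ℝ) (1 / (P : ℝ)),
      IsOrthonormalEigenbasis (cyclicPSD ℙ x P σ) (fun p => b p σ)
        (fun p => S (σ + ((p : ℕ) : ℝ) / (P : ℝ))) := by
    intro σ hσ
    have h1 : (fun p : Fin P => S (σ + ((p : ℕ) : ℝ) / (P : ℝ))) = μ σ := by
      ext p
      obtain ⟨h1, h2⟩ := hι p σ hσ
      simp only [hS, h1, h2]
    rw [h1]; exact hE σ
  exact ⟨b, φ, S, hb, hcs, hES, (hcs.isKLEigenbasis_iff hx hsum fun p =>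
    (hb p).aemeasurable).2 ((ae_restrict_iff' measurableSet_Ico).2 (Eventually.of_forall hES))⟩

end CycloKL

end

theorem theorem1 {Ω : Type*} [MeasurableSpace Ω] (ℙ : Measure Ω) [IsProbabilityMeasure ℙ]
    (x : ℤ → Ω → ℂ) (P : ℕ) (hx : CycloKL.IsCyclostationary ℙ x P)
    (hsum : ∀ n : ℤ, Summable fun m : ℤ => ‖CycloKL.autocorr ℙ x n m‖) :
    -- the cyclic PSD matrix is Hermitian and non-negative definite
    (∀ σ ∈ Ico (0 : ℝ) (1 / (P : ℝ)), (CycloKL.cyclicPSD ℙ x P σ).PosSemidef) ∧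
    -- eigenfunctions of the proposed form are exactly given by eigenvectors of that matrix
    (∀ σ ∈ Ico (0 : ℝ) (1 / (P : ℝ)), ∀ (b : Fin P → ℂ) (μ : ℂ),
      (CycloKL.csFun b σ ≠ 0 ∧ CycloKL.Eigenequation ℙ x (CycloKL.csFun b σ) μ) ↔
        (b ≠ 0 ∧ CycloKL.cyclicPSD ℙ x P σ *ᵥ b = μ • b)) ∧
    -- a family of the proposed form is a KL eigenbasis with KL spectrum `S` exactly if its
    -- coefficient vectors are orthonormal eigenvectors with eigenvalues `S (σ + p / P)`
    (∀ (b : Fin P → ℝ → Fin P → ℂ) (φ : ℤ → ℝ → ℂ) (S : ℝ → ℝ),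
      (∀ p, AEMeasurable (b p) (volume.restrict (Ico (0 : ℝ) (1 / (P : ℝ))))) →
      CycloKL.HasCSForm P φ b →
      (CycloKL.IsKLEigenbasis ℙ x φ S ↔
        ∀ᵐ σ ∂(volume.restrict (Ico (0 : ℝ) (1 / (P : ℝ)))),
          CycloKL.IsOrthonormalEigenbasis (CycloKL.cyclicPSD ℙ x P σ) (fun p => b p σ)
            (fun p => S (σ + ((p : ℕ) : ℝ) / (P : ℝ))))) ∧
    -- such a KL eigenbasis exists
    (∃ (b : Fin P → ℝ → Fin P → ℂ) (φ : ℤ → ℝ → ℂ) (S : ℝ → ℝ),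
      (∀ p, Measurable (b p)) ∧ CycloKL.HasCSForm P φ b ∧
      (∀ σ ∈ Ico (0 : ℝ) (1 / (P : ℝ)),
        CycloKL.IsOrthonormalEigenbasis (CycloKL.cyclicPSD ℙ x P σ) (fun p => b p σ)
          (fun p => S (σ + ((p : ℕ) : ℝ) / (P : ℝ)))) ∧
      CycloKL.IsKLEigenbasis ℙ x φ S) := by
  refine ⟨fun σ _ => CycloKL.posSemidef_cyclicPSD hx hsum σ, fun σ _ b μ => ?_,
    fun b φ S hb hφ => hφ.isKLEigenbasis_iff hx hsum hb, CycloKL.exists_isKLEigenbasis hx hsum⟩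
  rw [CycloKL.csFun_ne_zero_iff, CycloKL.eigenequation_csFun_iff hx hsum]
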